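/- Let $n\ge 1$, let $\mathbb D^n$ be the open unit polydisc, $\mathbb T^n$ the torus, and $m_n$ normalized Lebesgue measure on $\mathbb T^n$. Put $$C(z,w)=\prod_{j=1}^n\frac1{1-z_j\overline{w_j}},\qquad P(z,\zeta)=\frac{C(z,\zeta)\,C(\zeta,z)}{C(z,z)}\qquad(z\in\mathbb D^n,\ \zeta\in\mathbb T^n),$$ where $C(z,w)$ is used for $z,w\in\mathbb D^n\cup\mathbb T^n$ that do not both lie in $\mathbb T^n$. Let $H^2$ be the Hardy space of holomorphic functions $f$ on $\mathbb D^n$ with $\sup_{0<r<1}\int_{\mathbb T^n}|f(r\zeta)|^2\,dm_n(\zeta)<\infty$, identified with the space of their radial boundary values in $L^2(m_n)$. Let $I$ be an inner function on $\mathbb D^n$, that is, a holomorphic function $I:\mathbb D^n\to\mathbb D$ such that for $m_n$-a.e. $\zeta\in\mathbb T^n$ the limit $\lim_{r\to1-}I(r\zeta)$ exists and has modulus $1$. Let $\alpha\in\mathbb T$. Let $\sigma_\alpha=\sigma_\alpha[I]$ be the Clark measure, that is, the finite positive Borel measure on $\mathbb T^n$ such that $$\int_{\mathbb T^n}P(z,\zeta)\,d\sigma_\alpha(\zeta)=\operatorname{Re}\frac{\alpha+I(z)}{\alpha-I(z)}\qquad(z\in\mathbb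 D^n);$$ such a measure exists. Let $K_I=H^2\ominus I H^2$ and, for $w\in\mathbb D^n$, $$K_w(z)=\bigl(1-I(z)\overline{I(w)}\bigr)\,C(z,w),\qquad z\in\mathbb D^n.$$ Then $K_w\in K_I$ for every $w\in\mathbb D^n$, and $\langle f,K_w\rangle_{H^2}=f(w)$ for all $f\in K_I$. Moreover, there is exactly one linear isometry $T_\alpha:K_I\to L^2(\sigma_\alpha)$ (not necessarily onto) such that for every $w\in\mathbb D^n$ $$(T_\alpha K_w)(\xi)=\bigl(1-\alpha\overline{I(w)}\bigr)\,C(\xi,w)\qquad\text{for }\sigma_\alpha\text{-a.e. }\xi\in\mathbb T^n.$$ -/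

import Mathlib

open MeasureTheory Filter Topology Set
open scoped ENNReal ComplexConjugate

noncomputable section

namespace ClarkTorus

/-! ### The polydisc, the torus and its normalized Lebesgue measure -/

/-- The open unit polydisc in `ℂⁿ`. -/
def polydisc (n : ℕ) : Set (Fin n → ℂ) := {z | ∀ j, ‖z j‖ < 1}

instance circleMeasurableSpace : MeasurableSpace Circle := borel Circle

instance circleBorelSpace : BorelSpace Circle := ⟨rfl⟩

/-- The torus `𝕋ⁿ`, the distinguished boundary of the polydisc, with its Borel `σ`-algebra. -/
abbrev Torus (n : ℕ) : Type := Fin n → Circle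

/-- A point of the torus as a point of `ℂⁿ`. -/
def toC {n : ℕ} (ζ : Torus n) : Fin n → ℂ := fun j => (ζ j : ℂ)

/-- Normalized Lebesgue measure on the unit circle: the image of the uniform probability measure
on `ℝ / ℤ` under `x ↦ exp (2 π i x)`. -/
def circleMeasure : Measure Circle :=
  (AddCircle.haarAddCircle : Measure UnitAddCircle).map AddCircle.toCircle

instance circleMeasure_isProbabilityMeasure : IsProbabilityMeasure circleMeasure :=
  Measure.isProbabilityMeasure_map AddCircle.continuous_toCircle.measurable.aemeasurable

/-- Normalized Lebesgue measure on the torus `𝕋ⁿ`. -/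
def torusMeasure (n : ℕ) : Measure (Torus n) := Measure.pi fun _ => circleMeasure

instance torusMeasure_isProbabilityMeasure (n : ℕ) : IsProbabilityMeasure (torusMeasure n) := by
  unfold torusMeasure; infer_instance

/-! ### Cauchy and Poisson kernels, Clark measures -/

/-- The Cauchy kernel `C(z, w) = ∏ⱼ 1 / (1 - zⱼ * conj wⱼ)`. -/
def cauchyKernel {n : ℕ} (z w : Fin n → ℂ) : ℂ := ∏ j, 1 / (1 - z j * conj (w j))

/-- The Poisson kernel `P(z, ζ) = C(z, ζ) C(ζ, z) / C(z, z)`, for `z` in the polydisc and `ζ` on the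
torus. -/
def poissonKernel {n : ℕ} (z : Fin n → ℂ) (ζ : Torus n) : ℂ :=
  cauchyKernel z (toC ζ) * cauchyKernel (toC ζ) z / cauchyKernel z z

/-- `σ` is a finite positive Borel measure on the torus whose Poisson integral is
`Re ((α + φ) / (α - φ))` on the polydisc. At most one measure has this property, since a finite
Borel measure on the torus is determined by its Poisson integral. -/
structure IsClarkMeasure {n : ℕ} (φ : (Fin n → ℂ) → ℂ) (α : Circle) (σ : Measure (Torus n)) :
    Prop where
  isFiniteMeasure : IsFiniteMeasure σ
  poisson : ∀ z ∈ polydisc n,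
    ∫ ζ, poissonKernel z ζ ∂σ = ((((α : ℂ) + φ z) / ((α : ℂ) - φ z)).re : ℂ)

open Classical in
/-- The Clark measure `σ_α[φ]`: the measure on the torus whose Poisson integral is
`Re ((α + φ) / (α - φ))` (and `0` when there is none, which does not happen when `φ` is a
holomorphic map from the polydisc to the unit disc). -/
def clarkMeasure {n : ℕ} (φ : (Fin n → ℂ) → ℂ) (α : Circle) : Measure (Torus n) :=
  if h : ∃ σ, IsClarkMeasure φ α σ then h.choose else 0

/-! ### Boundary values, inner functions, Hardy space -/

/-- `g` is the radial boundary function of `f`: `f (r ζ) → g ζ` as `r → 1-`, for almost every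
point `ζ` of the torus. -/
def HasBoundaryValues {n : ℕ} (f : (Fin n → ℂ) → ℂ) (g : Torus n → ℂ) : Prop :=
  ∀ᵐ ζ ∂(torusMeasure n), Tendsto (fun r : ℝ => f ((r : ℂ) • toC ζ)) (𝓝[<] 1) (𝓝 (g ζ))

/-- Inner functions on the polydisc: holomorphic maps to the open unit disc whose radial limit
has modulus one at almost every point of the torus. -/
structure IsInner {n : ℕ} (I : (Fin n → ℂ) → ℂ) : Prop where
  holo : DifferentiableOn ℂ I (polydisc n)
  norm_lt_one : ∀ z ∈ polydisc n, ‖I z‖ < 1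
  boundary : ∀ᵐ ζ ∂(torusMeasure n), ∃ c : ℂ, ‖c‖ = 1 ∧
    Tendsto (fun r : ℝ => I ((r : ℂ) • toC ζ)) (𝓝[<] 1) (𝓝 c)

/-- The Hardy space `H²` of the polydisc: `f` is holomorphic there and
`sup_{0 < r < 1} ∫ |f (r ζ)|² dm(ζ) < ∞`. -/
structure MemHardy {n : ℕ} (f : (Fin n → ℂ) → ℂ) : Prop where
  holo : DifferentiableOn ℂ f (polydisc n)
  bdd : ⨆ r ∈ Ioo (0 : ℝ) 1, ∫⁻ ζ, ‖f ((r : ℂ) • toC ζ)‖ₑ ^ 2 ∂(torusMeasure n) < ∞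

theorem continuous_dilate {n : ℕ} {f : (Fin n → ℂ) → ℂ} (hf : DifferentiableOn ℂ f (polydisc n))
    {r : ℝ} (hr : r ∈ Ioo (0 : ℝ) 1) : Continuous fun ζ : Torus n => f ((r : ℂ) • toC ζ) := by
  refine hf.continuousOn.comp_continuous ?_ fun ζ j => ?_
  · unfold toC
    fun_prop
  · simpa [toC, abs_of_pos hr.1, Circle.norm_coe] using hr.2

theorem MemHardy.zero {n : ℕ} : MemHardy (fun _ : Fin n → ℂ => (0 : ℂ)) :=
  ⟨differentiableOn_const _, by simp⟩

theorem MemHardy.add {n : ℕ} {f g : (Fin n → ℂ) → ℂ} (hf : MemHardy f) (hg : MemHardy g) :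
    MemHardy (fun z => f z + g z) := by
  refine ⟨hf.holo.add hg.holo, ?_⟩
  set A := ⨆ r ∈ Ioo (0 : ℝ) 1, ∫⁻ ζ, ‖f ((r : ℂ) • toC ζ)‖ₑ ^ 2 ∂(torusMeasure n) with hA
  set B := ⨆ r ∈ Ioo (0 : ℝ) 1, ∫⁻ ζ, ‖g ((r : ℂ) • toC ζ)‖ₑ ^ 2 ∂(torusMeasure n) with hB
  have hfin : 2 * (A + B) < ∞ :=
    ENNReal.mul_lt_top (by simp) (ENNReal.add_lt_top.2 ⟨hf.bdd, hg.bdd⟩)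
  refine lt_of_le_of_lt (iSup₂_le fun r hr => ?_) hfin
  have hcf := continuous_dilate hf.holo hr
  calc ∫⁻ ζ, ‖f ((r : ℂ) • toC ζ) + g ((r : ℂ) • toC ζ)‖ₑ ^ 2 ∂(torusMeasure n)
      ≤ ∫⁻ ζ, 2 * (‖f ((r : ℂ) • toC ζ)‖ₑ ^ 2 + ‖g ((r : ℂ) • toC ζ)‖ₑ ^ 2)
          ∂(torusMeasure n) := by
        refine lintegral_mono fun ζ => ?_
        refine (pow_le_pow_left' (enorm_add_le _ _) 2).trans ?_
        have h := ENNReal.rpow_add_le_mul_rpow_add_rpow ‖f ((r : ℂ) • toC ζ)‖ₑ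
          ‖g ((r : ℂ) • toC ζ)‖ₑ (p := 2) (by norm_num)
        norm_num at h
        exact h
    _ = 2 * (∫⁻ ζ, ‖f ((r : ℂ) • toC ζ)‖ₑ ^ 2 ∂(torusMeasure n)
          + ∫⁻ ζ, ‖g ((r : ℂ) • toC ζ)‖ₑ ^ 2 ∂(torusMeasure n)) := by
        rw [lintegral_const_mul' _ _ (by simp), lintegral_add_left]
        exact (hcf.enorm.measurable).pow_const 2
    _ ≤ 2 * (A + B) := by
        gcongr
        · exact le_iSup₂_of_le r hr le_rfl
        · exact le_iSup₂_of_le r hr le_rfl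

theorem MemHardy.smul {n : ℕ} {f : (Fin n → ℂ) → ℂ} (c : ℂ) (hf : MemHardy f) :
    MemHardy (fun z => c * f z) := by
  refine ⟨hf.holo.const_mul c, ?_⟩
  have hfin := ENNReal.mul_lt_top (a := ‖c‖ₑ ^ 2) (ENNReal.pow_lt_top enorm_lt_top) hf.bdd
  refine lt_of_le_of_lt (iSup₂_le fun r hr => ?_) hfin
  simp_rw [enorm_mul, mul_pow]
  rw [lintegral_const_mul' _ _ (ENNReal.pow_lt_top enorm_lt_top).ne]
  gcongr
  exact le_iSup₂_of_le r hr le_rfl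

/-- For a function `u` on the polydisc, the space `u H²`, realized as the subspace of `L²(𝕋ⁿ)` of
the boundary functions of the products `u h`, with `h` in the Hardy space. -/
def mulHardy {n : ℕ} (u : (Fin n → ℂ) → ℂ) : Submodule ℂ (Lp ℂ 2 (torusMeasure n)) where
  carrier := {g | ∃ h : (Fin n → ℂ) → ℂ, MemHardy h ∧ HasBoundaryValues (fun z => u z * h z) g}
  zero_mem' := by
    refine ⟨fun _ => 0, MemHardy.zero, ?_⟩
    filter_upwards [Lp.coeFn_zero ℂ 2 (torusMeasure n)] with ζ h
    rw [h]
    simp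
  add_mem' := by
    rintro g₁ g₂ ⟨h₁, H₁, b₁⟩ ⟨h₂, H₂, b₂⟩
    refine ⟨_, H₁.add H₂, ?_⟩
    filter_upwards [b₁, b₂, Lp.coeFn_add g₁ g₂] with ζ t₁ t₂ h
    rw [h]
    simpa [mul_add] using t₁.add t₂
  smul_mem' := by
    rintro c g ⟨h, H, b⟩
    refine ⟨_, H.smul c, ?_⟩
    filter_upwards [b, Lp.coeFn_smul c g] with ζ t h
    rw [h]
    simpa [mul_left_comm] using t.const_mul c

/-- The Hardy space `H²`, identified with the subspace of `L²(𝕋ⁿ)` of boundary functions of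
the functions in the Hardy space of the polydisc. -/
def hardySpace (n : ℕ) : Submodule ℂ (Lp ℂ 2 (torusMeasure n)) := mulHardy fun _ => 1

/-- The space `K_I = H² ⊖ I H²`, the orthogonal complement of `I H²` in `H²`. -/
def modelSpace {n : ℕ} (I : (Fin n → ℂ) → ℂ) : Submodule ℂ (Lp ℂ 2 (torusMeasure n)) :=
  hardySpace n ⊓ (mulHardy I)ᗮ

/-- The kernel function `K_w(z) = (1 - I(z) conj I(w)) C(z, w)`. -/
def modelKernel {n : ℕ} (I : (Fin n → ℂ) → ℂ) (w z : Fin n → ℂ) : ℂ :=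
  (1 - I z * conj (I w)) * cauchyKernel z w

end ClarkTorus

end

namespace ClarkTorus

/-! ### Integration on the torus and the Cauchy formula -/

/-! An isometry is fixed by its values on a family with dense span, and it exists as soon as the
prescribed images have the same Gram matrix (`existsUnique_linearIsometry_of_inner_eq`). So two
facts are needed: the kernels `K_w` span a dense subspace of `K_I`, and the functions `(1 - α conj
I(w)) C(·, w)` have the Gram matrix of the `K_w` in `L²(σ)`.

Gram matrix. Put `H = (α + I) / (α - I)`. The core is `integral_cauchyKernel_mul_of_poisson`: `∫
C(w,ξ) C(ξ,v) dσ = C(w,v) (H(w) + conj H(v)) / 2`. For the measure `Re H(rζ) dm` in place of `σ`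
this is the Cauchy formula, applied to the two halves of `Re H = (H + conj H) / 2`. To pass to `σ`,
replace the product of kernels by its Poisson extension at radius `r`; by Fubini and the symmetry of
the Poisson kernel, its `σ`-integral equals the integral against `Re H(rζ) dm`, and `r → 1` gives
the formula. The algebra in `herglotz_add_conj` then turns the right-hand side into `K_v(w)`, which
is also the Gram matrix in `K_I` by the reproducing property.

Density. The Cauchy kernels span a dense subspace of `H²`, because dilates of a Hardy function are
averages of them and converge weakly to its boundary values. Since `C(·, w) - K_w` is a multiple of
`I C(·, w)`, the projection onto the orthogonal complement of `I H²` carries `C(·, w)` to `K_w`, and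
density descends to `K_I`.

The Clark measure itself is a weak limit of the measures `Re H(rζ) dm`, which are positive and all
of mass `Re H(0)`. -/

theorem integral_circleMeasure (F : ℂ → ℂ) (hF : Continuous fun a : Circle => F a) :
    ∫ a : Circle, F a ∂circleMeasure = Real.circleAverage F 0 1 := by
  have hvol : (AddCircle.haarAddCircle : Measure UnitAddCircle) = volume := by
    rw [AddCircle.volume_eq_smul_haarAddCircle]; simp
  rw [circleMeasure, integral_map AddCircle.continuous_toCircle.measurable.aemeasurable
    hF.aestronglyMeasurable, hvol, ← UnitAddCircle.intervalIntegral_preimage 0,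
    Real.circleAverage]
  have h := intervalIntegral.integral_comp_mul_left (a := 0) (b := 1)
    (fun θ => F (circleMap 0 1 θ)) (c := 2 * Real.pi) (by positivity)
  simp only [mul_zero, mul_one] at h
  rw [← h]
  simp [AddCircle.toCircle_apply_mk, circleMap, Circle.coe_exp]

theorem continuous_toC {n : ℕ} : Continuous (toC : Torus n → Fin n → ℂ) := by
  unfold toC; fun_prop

theorem norm_toC {n : ℕ} (ζ : Torus n) (j : Fin n) : ‖toC ζ j‖ = 1 :=
  Circle.norm_coe _

theorem one_sub_mul_conj_ne_zero {a b : ℂ} (ha : ‖a‖ ≤ 1) (hb : ‖b‖ < 1) :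
    1 - a * conj b ≠ 0 := by
  intro h
  have h1 : ‖a * conj b‖ = 1 := by rw [← sub_eq_zero.1 h]; simp
  rw [norm_mul, RCLike.norm_conj] at h1
  nlinarith [norm_nonneg a, norm_nonneg b]

theorem one_sub_mul_conj_ne_zero' {a b : ℂ} (ha : ‖a‖ < 1) (hb : ‖b‖ ≤ 1) :
    1 - a * conj b ≠ 0 := by
  intro h
  have h1 : ‖a * conj b‖ = 1 := by rw [← sub_eq_zero.1 h]; simp
  rw [norm_mul, RCLike.norm_conj] at h1
  nlinarith [norm_nonneg a, norm_nonneg b]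

/-- The one-variable Cauchy formula. -/
theorem integral_circle_cauchy {G : ℂ → ℂ} (hG : ∀ z, ‖z‖ ≤ 1 → DifferentiableAt ℂ G z)
    {z : ℂ} (hz : ‖z‖ < 1) :
    ∫ a : Circle, 1 / (1 - z * conj (a : ℂ)) * G a ∂circleMeasure = G z := by
  have hc : DiffContOnCl ℂ G (Metric.ball 0 |1|) := by
    refine DifferentiableOn.diffContOnCl fun x hx => (hG x ?_).differentiableWithinAt
    rw [closure_ball _ (by norm_num)] at hx
    simpa using hx
  rw [← hc.circleAverage_smul_div (by simpa using hz)]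
  -- On the circle `conj a = 1 / a`, so the kernel becomes `a / (a - z)`, the form in the
  -- circle-average Cauchy formula.
  have h : ∀ a : Circle, 1 / (1 - z * conj (a : ℂ)) * G a =
      ((fun x : ℂ => ((x - 0) / (x - z)) • G x) a) := by
    intro a
    have ha : (a : ℂ) * conj (a : ℂ) = 1 := by
      simp [Complex.mul_conj, Complex.normSq_eq_norm_sq, Circle.norm_coe]
    have h1 : 1 - z * conj (a : ℂ) ≠ 0 := one_sub_mul_conj_ne_zero' hz (Circle.norm_coe _).le
    have h2 : (a : ℂ) - z ≠ 0 := by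
      intro h; rw [← sub_eq_zero.1 h, Circle.norm_coe] at hz; exact lt_irrefl _ hz
    have : 1 / (1 - z * conj (a : ℂ)) = a / (a - z) := by
      rw [div_eq_div_iff h1 h2]; linear_combination z * ha
    simp [this]
  simp_rw [h]
  refine integral_circleMeasure (fun x : ℂ => ((x - 0) / (x - z)) • G x) ?_
  simp_rw [← h]
  refine Continuous.mul ?_ ?_
  · refine Continuous.div (by fun_prop) (by fun_prop) fun a => ?_
    exact one_sub_mul_conj_ne_zero' hz (Circle.norm_coe _).le
  · exact continuous_iff_continuousAt.2 fun a =>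
      ContinuousAt.comp (f := fun a : Circle => (a : ℂ)) (hG a (Circle.norm_coe _).le).continuousAt
        (by fun_prop)

theorem integral_torus_succ {n : ℕ} (F : Torus (n + 1) → ℂ) (hF : Continuous F) :
    ∫ ζ, F ζ ∂(torusMeasure (n + 1)) =
      ∫ a, ∫ b, F (Fin.cons a b) ∂(torusMeasure n) ∂circleMeasure := by
  have h := (measurePreserving_piFinSuccAbove (fun _ : Fin (n + 1) => circleMeasure) 0).symm
  have hcont : Continuous fun p : Circle × Torus n => F (Fin.cons p.1 p.2) :=
    hF.comp (by fun_prop)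
  have hint : Integrable (fun p : Circle × Torus n => F (Fin.cons p.1 p.2))
      (circleMeasure.prod (torusMeasure n)) :=
    hcont.integrable_of_hasCompactSupport (HasCompactSupport.of_compactSpace _)
  rw [torusMeasure, ← h.integral_comp' F, ← integral_prod _ hint]
  refine integral_congr_ae (ae_of_all _ fun p => congrArg F ?_)
  ext j
  refine Fin.cases ?_ (fun j => ?_) j <;> simp [MeasurableEquiv.piFinSuccAbove]

theorem polydisc_zero_lt {n : ℕ} : (0 : Fin n → ℂ) ∈ polydisc n := fun j => by simp

theorem isOpen_polydisc (n : ℕ) : IsOpen (polydisc n) := by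
  simp only [polydisc, ofPred_forall]
  exact isOpen_iInter_of_finite fun j => isOpen_lt (by fun_prop) continuous_const

theorem continuous_comp_toC {n : ℕ} {G : (Fin n → ℂ) → ℂ}
    (hG : ∀ z, (∀ j, ‖z j‖ ≤ 1) → DifferentiableAt ℂ G z) : Continuous fun ζ => G (toC ζ) :=
  continuous_iff_continuousAt.2 fun ζ =>
    ContinuousAt.comp (f := toC) (hG _ fun j => (norm_toC ζ j).le).continuousAt
      continuous_toC.continuousAt

theorem continuous_cauchyKernel_right {n : ℕ} {z : Fin n → ℂ} (hz : z ∈ polydisc n) :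
    Continuous fun ζ => cauchyKernel z (toC ζ) := by
  unfold cauchyKernel toC
  refine continuous_finsetProd _ fun j _ => ?_
  refine Continuous.div (by fun_prop) (by fun_prop) fun a => ?_
  exact one_sub_mul_conj_ne_zero' (hz j) (Circle.norm_coe _).le

theorem conj_cauchyKernel {n : ℕ} (z w : Fin n → ℂ) :
    conj (cauchyKernel z w) = cauchyKernel w z := by
  simp [cauchyKernel, map_prod, mul_comm]

theorem continuous_cauchyKernel_left {n : ℕ} {z : Fin n → ℂ} (hz : z ∈ polydisc n) :
    Continuous fun ζ => cauchyKernel (toC ζ) z := by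
  simp_rw [← conj_cauchyKernel z]
  exact Complex.continuous_conj.comp (continuous_cauchyKernel_right hz)

theorem differentiableAt_cauchyKernel {n : ℕ} {w z : Fin n → ℂ}
    (h : ∀ j, 1 - z j * conj (w j) ≠ 0) :
    DifferentiableAt ℂ (fun z => cauchyKernel z w) z := by
  unfold cauchyKernel
  have hd : ∀ j, DifferentiableAt ℂ (fun z : Fin n → ℂ => 1 / (1 - z j * conj (w j))) z :=
    fun j => by
      have h1 : DifferentiableAt ℂ (fun z : Fin n → ℂ => 1 - z j * conj (w j)) z := by fun_prop
      simpa only [one_div] using h1.fun_inv (h j)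
  exact (HasFDerivAt.finsetProd fun j _ => (hd j).hasFDerivAt).differentiableAt

theorem cauchyKernel_ne_zero {n : ℕ} {w z : Fin n → ℂ}
    (h : ∀ j, 1 - z j * conj (w j) ≠ 0) : cauchyKernel z w ≠ 0 :=
  Finset.prod_ne_zero_iff.2 fun j _ => one_div_ne_zero (h j)

/-- The Cauchy formula on the polydisc. -/
theorem integral_cauchyKernel_mul {n : ℕ} {G : (Fin n → ℂ) → ℂ}
    (hG : ∀ z, (∀ j, ‖z j‖ ≤ 1) → DifferentiableAt ℂ G z) {z : Fin n → ℂ}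
    (hz : z ∈ polydisc n) :
    ∫ ζ, cauchyKernel z (toC ζ) * G (toC ζ) ∂(torusMeasure n) = G z := by
  induction n with
  | zero =>
    have : ∀ ζ : Torus 0, toC ζ = z := fun ζ => Subsingleton.elim _ _
    simp [this, cauchyKernel]
  | succ n ih =>
    have hcons : ∀ x : ℂ, ‖x‖ ≤ 1 → ∀ y : Fin n → ℂ, (∀ j, ‖y j‖ ≤ 1) →
        DifferentiableAt ℂ G (Fin.cons x y) := fun x hx y hy => by
      refine hG _ fun j => ?_
      refine Fin.cases ?_ (fun j => ?_) j
      · simpa using hx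
      · simpa using hy j
    rw [integral_torus_succ (fun ζ => cauchyKernel z (toC ζ) * G (toC ζ))
      ((continuous_cauchyKernel_right hz).mul (continuous_comp_toC hG))]
    have hk : ∀ (a : Circle) (b : Torus n), cauchyKernel z (toC (Fin.cons a b)) *
        G (toC (Fin.cons a b)) = 1 / (1 - z 0 * conj (a : ℂ)) *
          (cauchyKernel (Fin.tail z) (toC b) * G (Fin.cons (a : ℂ) (toC b))) := by
      intro a b
      have h1 : toC (Fin.cons a b : Torus (n + 1)) = Fin.cons (a : ℂ) (toC b) := by
        ext j
        refine Fin.cases ?_ (fun j => ?_) j <;> simp [toC]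
      rw [h1, ← mul_assoc]
      simp [cauchyKernel, Fin.prod_univ_succ, Fin.tail, mul_comm]
    simp_rw [hk, integral_const_mul]
    -- With the first coordinate frozen on the circle, the inner integral is the induction
    -- hypothesis; what remains is the one-variable formula in that coordinate.
    have hin : ∀ a : Circle, ∫ b, cauchyKernel (Fin.tail z) (toC b) *
        G (Fin.cons (a : ℂ) (toC b)) ∂(torusMeasure n) = G (Fin.cons (a : ℂ) (Fin.tail z)) := by
      intro a
      refine ih (G := fun y => G (Fin.cons (a : ℂ) y)) (fun y hy => ?_) fun j => hz _
      refine DifferentiableAt.comp y (hcons a (Circle.norm_coe _).le y hy) ?_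
      refine differentiableAt_pi.2 fun j => ?_
      refine Fin.cases ?_ (fun j => ?_) j
      · simp
      · simp only [Fin.cons_succ]
        fun_prop
    simp_rw [hin]
    rw [integral_circle_cauchy (G := fun x => G (Fin.cons x (Fin.tail z))) (fun x hx => ?_) (hz 0),
      Fin.cons_self_tail]
    refine DifferentiableAt.comp x (hcons x hx _ fun j => (hz _).le) ?_
    refine differentiableAt_pi.2 fun j => ?_
    refine Fin.cases ?_ (fun j => ?_) j
    · simp
    · simp

theorem differentiableAt_mul_cauchyKernel {n : ℕ} {F : (Fin n → ℂ) → ℂ}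
    (hF : ∀ z, (∀ j, ‖z j‖ ≤ 1) → DifferentiableAt ℂ F z) {v : Fin n → ℂ} (hv : v ∈ polydisc n)
    (z : Fin n → ℂ) (hz : ∀ j, ‖z j‖ ≤ 1) :
    DifferentiableAt ℂ (fun z => cauchyKernel z v * F z) z :=
  (differentiableAt_cauchyKernel fun j => one_sub_mul_conj_ne_zero (hz j) (hv j)).mul (hF z hz)

theorem continuous_cauchyKernel_mul {n : ℕ} {w v : Fin n → ℂ} (hw : w ∈ polydisc n)
    (hv : v ∈ polydisc n) :
    Continuous fun ζ => cauchyKernel w (toC ζ) * cauchyKernel (toC ζ) v :=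
  (continuous_cauchyKernel_right hw).mul (continuous_cauchyKernel_left hv)

theorem Continuous.integrable_torus {n : ℕ} {F : Torus n → ℂ} (hF : Continuous F)
    (μ : Measure (Torus n)) [IsFiniteMeasure μ] : Integrable F μ :=
  hF.integrable_of_hasCompactSupport (HasCompactSupport.of_compactSpace _)

/-- The integral of the real part of a holomorphic function against a product of two Cauchy
kernels. -/
theorem integral_cauchyKernel_mul_cauchyKernel_mul_re {n : ℕ} {F : (Fin n → ℂ) → ℂ}
    (hF : ∀ z, (∀ j, ‖z j‖ ≤ 1) → DifferentiableAt ℂ F z) {w v : Fin n → ℂ}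
    (hw : w ∈ polydisc n) (hv : v ∈ polydisc n) :
    ∫ ζ, cauchyKernel w (toC ζ) * cauchyKernel (toC ζ) v * ((F (toC ζ)).re : ℂ)
      ∂(torusMeasure n) = cauchyKernel w v * ((F w + conj (F v)) / 2) := by
  have hc := continuous_comp_toC hF
  -- The half `F` is paired with the holomorphic factor `C(·, v)` and evaluated at `w`; the half
  -- `conj F` is the conjugate of the same formula with `w` and `v` exchanged.
  have h1 := integral_cauchyKernel_mul (differentiableAt_mul_cauchyKernel hF hv) hw
  have h2 := congrArg conj (integral_cauchyKernel_mul (differentiableAt_mul_cauchyKernel hF hw) hv)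
  rw [← integral_conj] at h2
  simp only [map_mul, conj_cauchyKernel] at h2
  have h3 : ∀ ζ : Torus n, cauchyKernel w (toC ζ) * cauchyKernel (toC ζ) v *
      ((F (toC ζ)).re : ℂ) = (1 / 2) * (cauchyKernel w (toC ζ) * (cauchyKernel (toC ζ) v *
        F (toC ζ))) + (1 / 2) * (cauchyKernel (toC ζ) v * (cauchyKernel w (toC ζ) *
          conj (F (toC ζ)))) := by
    intro ζ
    rw [Complex.re_eq_add_conj]
    ring
  simp_rw [h3]
  rw [integral_add, integral_const_mul, integral_const_mul, h1, h2]
  · ring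
  · refine Continuous.integrable_torus ?_ _
    exact continuous_const.mul ((continuous_cauchyKernel_right hw).mul
      ((continuous_cauchyKernel_left hv).mul hc))
  · refine Continuous.integrable_torus ?_ _
    exact continuous_const.mul ((continuous_cauchyKernel_left hv).mul
      ((continuous_cauchyKernel_right hw).mul (Complex.continuous_conj.comp hc)))

theorem cauchyKernel_self_ne_zero {n : ℕ} {z : Fin n → ℂ} (hz : z ∈ polydisc n) :
    cauchyKernel z z ≠ 0 :=
  cauchyKernel_ne_zero fun j => one_sub_mul_conj_ne_zero (hz j).le (hz j)

/-- The Poisson formula on the polydisc. -/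
theorem integral_poissonKernel_mul_re {n : ℕ} {F : (Fin n → ℂ) → ℂ}
    (hF : ∀ z, (∀ j, ‖z j‖ ≤ 1) → DifferentiableAt ℂ F z) {z : Fin n → ℂ} (hz : z ∈ polydisc n) :
    ∫ ζ, poissonKernel z ζ * ((F (toC ζ)).re : ℂ) ∂(torusMeasure n) = ((F z).re : ℂ) := by
  have h := integral_cauchyKernel_mul_cauchyKernel_mul_re hF hz hz
  have h1 : ∀ ζ : Torus n, poissonKernel z ζ * ((F (toC ζ)).re : ℂ) = (cauchyKernel z z)⁻¹ *
      (cauchyKernel z (toC ζ) * cauchyKernel (toC ζ) z * ((F (toC ζ)).re : ℂ)) := fun ζ => by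
    rw [poissonKernel]; ring
  simp_rw [h1]
  rw [integral_const_mul, h, Complex.re_eq_add_conj, inv_mul_cancel_left₀
    (cauchyKernel_self_ne_zero hz)]

theorem continuous_poissonKernel {n : ℕ} {z : Fin n → ℂ} (hz : z ∈ polydisc n) :
    Continuous (poissonKernel z) :=
  (continuous_cauchyKernel_mul hz hz).div_const _

/-- The Cauchy and Poisson formulas ask for differentiability at every point of the closed polydisc.
Dilates have it, and other functions are reached by letting `r → 1`. -/
theorem differentiableAt_dilate {n : ℕ} {f : (Fin n → ℂ) → ℂ}
    (hf : DifferentiableOn ℂ f (polydisc n)) {r : ℝ} (hr : r ∈ Ioo (0 : ℝ) 1) (z : Fin n → ℂ)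
    (hz : ∀ j, ‖z j‖ ≤ 1) : DifferentiableAt ℂ (fun z => f ((r : ℂ) • z)) z := by
  refine DifferentiableAt.comp z (hf.differentiableAt ((isOpen_polydisc n).mem_nhds fun j => ?_))
    (by fun_prop)
  have := hz j
  simp only [Pi.smul_apply, smul_eq_mul, norm_mul, Complex.norm_real, Real.norm_eq_abs,
    abs_of_pos hr.1]
  nlinarith [hr.1, hr.2, norm_nonneg (z j)]

theorem smul_mem_polydisc {n : ℕ} {z : Fin n → ℂ} (hz : ∀ j, ‖z j‖ ≤ 1) {r : ℝ}
    (hr : r ∈ Ioo (0 : ℝ) 1) : (r : ℂ) • z ∈ polydisc n := fun j => by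
  have := hz j
  simp only [Pi.smul_apply, smul_eq_mul, norm_mul, Complex.norm_real, Real.norm_eq_abs,
    abs_of_pos hr.1]
  nlinarith [hr.1, hr.2, norm_nonneg (z j)]

theorem tendsto_dilate {n : ℕ} {f : (Fin n → ℂ) → ℂ} (hf : DifferentiableOn ℂ f (polydisc n))
    {z : Fin n → ℂ} (hz : z ∈ polydisc n) :
    Tendsto (fun r : ℝ => f ((r : ℂ) • z)) (𝓝[<] 1) (𝓝 (f z)) := by
  have h : ContinuousAt f (((1 : ℝ) : ℂ) • z) := by
    simpa using (hf.differentiableAt ((isOpen_polydisc n).mem_nhds hz)).continuousAt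
  have h2 : ContinuousAt (fun r : ℝ => f ((r : ℂ) • z)) 1 :=
    ContinuousAt.comp (f := fun r : ℝ => (r : ℂ) • z) h (by fun_prop)
  simpa using h2.tendsto.mono_left nhdsWithin_le_nhds

theorem Ioo_mem_nhdsLT_one : ∀ᶠ r : ℝ in 𝓝[<] 1, r ∈ Ioo (0 : ℝ) 1 :=
  Ioo_mem_nhdsLT one_pos

/-! ### Existence of Clark measures -/

theorem poissonKernel_zero {n : ℕ} (ζ : Torus n) : poissonKernel 0 ζ = 1 := by
  simp [poissonKernel, cauchyKernel]

/-- The Poisson kernel at the origin is `1`. Since the mass does not depend on `r`, one constant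
normalizes all the dilated densities to probability densities. -/
theorem integral_re_dilate {n : ℕ} {F : (Fin n → ℂ) → ℂ}
    (hF : DifferentiableOn ℂ F (polydisc n)) {r : ℝ} (hr : r ∈ Ioo (0 : ℝ) 1) :
    ∫ ζ, (F ((r : ℂ) • toC ζ)).re ∂(torusMeasure n) = (F 0).re := by
  have h := integral_poissonKernel_mul_re (differentiableAt_dilate hF hr) polydisc_zero_lt
  simp only [poissonKernel_zero, one_mul, smul_zero] at h
  rw [integral_complex_ofReal] at h
  exact_mod_cast h

/-- A holomorphic function with positive real part on the polydisc is the Poisson integral of a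
finite measure. -/
theorem exists_measure_poisson {n : ℕ} {F : (Fin n → ℂ) → ℂ}
    (hF : DifferentiableOn ℂ F (polydisc n)) (hpos : ∀ z ∈ polydisc n, 0 < (F z).re) :
    ∃ σ : Measure (Torus n), IsFiniteMeasure σ ∧
      ∀ z ∈ polydisc n, ∫ ζ, poissonKernel z ζ ∂σ = ((F z).re : ℂ) := by
  obtain ⟨r, -, hr, hr1⟩ := exists_seq_strictMono_tendsto' (zero_lt_one' ℝ)
  set c : ℝ := (F 0).re with hc
  have hc0 : 0 < c := hpos 0 polydisc_zero_lt
  let d : ℕ → Torus n → ℝ := fun k ζ => (F ((r k : ℂ) • toC ζ)).re / c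
  have hd0 : ∀ k ζ, 0 ≤ d k ζ := fun k ζ => div_nonneg
    (hpos _ (smul_mem_polydisc (fun j => (norm_toC ζ j).le) (hr k))).le hc0.le
  have hdc : ∀ k, Continuous (d k) := fun k =>
    (Complex.continuous_re.comp (continuous_dilate hF (hr k))).div_const _
  have hdi : ∀ k, Integrable (d k) (torusMeasure n) := fun k =>
    (hdc k).integrable_of_hasCompactSupport (HasCompactSupport.of_compactSpace _)
  have hd1 : ∀ k, ∫ ζ, d k ζ ∂(torusMeasure n) = 1 := fun k => by
    simp only [d]
    rw [integral_div, integral_re_dilate hF (hr k), div_self hc0.ne']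
  let μ : ℕ → ProbabilityMeasure (Torus n) := fun k =>
    ⟨(torusMeasure n).withDensity fun ζ => ENNReal.ofReal (d k ζ), ⟨by
      rw [withDensity_apply _ MeasurableSet.univ, Measure.restrict_univ,
        ← ofReal_integral_eq_lintegral_ofReal (hdi k) (ae_of_all _ (hd0 k)), hd1]
      simp⟩⟩
  have hμ : ∀ k (f : Torus n → ℂ), ∫ ζ, f ζ ∂(μ k : Measure (Torus n)) =
      (∫ ζ, f ζ * ((F ((r k : ℂ) • toC ζ)).re : ℂ) ∂(torusMeasure n)) / c := fun k f => by
    change ∫ ζ, f ζ ∂((torusMeasure n).withDensity fun ζ => ENNReal.ofReal (d k ζ)) = _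
    rw [integral_withDensity_eq_integral_toReal_smul (hdc k).measurable.ennreal_ofReal
      (ae_of_all _ fun ζ => ENNReal.ofReal_lt_top), ← integral_div]
    refine integral_congr_ae (ae_of_all _ fun ζ => ?_)
    simp only [ENNReal.toReal_ofReal (hd0 k ζ), Complex.real_smul, d, Complex.ofReal_div]
    ring
  -- Compactness of the space of probability measures on the torus gives a weak limit along an
  -- ultrafilter finer than `atTop`, so no subsequence has to be extracted.
  let U : Ultrafilter ℕ := hyperfilter ℕ
  have hU : (U : Filter ℕ) ≤ atTop := by
    rw [← Nat.cofinite_eq_atTop]; exact hyperfilter_le_cofinite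
  obtain ⟨ν, -, hν⟩ := isCompact_univ.ultrafilter_le_nhds (U.map μ) (by simp)
  have hν' : Tendsto μ U (𝓝 ν) := hν
  rw [ProbabilityMeasure.tendsto_iff_forall_integral_rclike_tendsto ℂ] at hν'
  refine ⟨ENNReal.ofReal c • (ν : Measure (Torus n)),
    Measure.smul_finite _ ENNReal.ofReal_ne_top, fun z hz => ?_⟩
  rw [integral_smul_measure, ENNReal.toReal_ofReal hc0.le]
  have h1 := hν' (BoundedContinuousFunction.mkOfCompact ⟨_, continuous_poissonKernel hz⟩)
  simp only [BoundedContinuousFunction.mkOfCompact_apply, ContinuousMap.coe_mk, hμ] at h1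
  -- For fixed `z` the Poisson kernel is a continuous test function, and its integrals against `μ k`
  -- are `Re F(r_k z) / c`, which identifies the limit.
  have h2 : ∀ k, ∫ ζ, poissonKernel z ζ * ((F ((r k : ℂ) • toC ζ)).re : ℂ) ∂(torusMeasure n) =
      ((F ((r k : ℂ) • z)).re : ℂ) := fun k =>
    integral_poissonKernel_mul_re (differentiableAt_dilate hF (hr k)) hz
  simp only [h2] at h1
  have hr2 : Tendsto r atTop (𝓝[<] 1) :=
    tendsto_nhdsWithin_iff.2 ⟨hr1, Eventually.of_forall fun k => (hr k).2⟩
  have h3 : Tendsto (fun k => ((F ((r k : ℂ) • z)).re : ℂ) / (c : ℂ)) U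
      (𝓝 (((F z).re : ℂ) / c)) :=
    (((Complex.continuous_ofReal.comp Complex.continuous_re).continuousAt.tendsto.comp
      ((tendsto_dilate hF hz).comp (hr2.mono_left hU))).div_const _)
  rw [tendsto_nhds_unique h1 h3, Complex.real_smul,
    mul_div_cancel₀ _ (Complex.ofReal_ne_zero.2 hc0.ne')]

/-- The Herglotz transform `(α + φ) / (α - φ)`. -/
noncomputable def herglotz {n : ℕ} (φ : (Fin n → ℂ) → ℂ) (α : Circle) (z : Fin n → ℂ) : ℂ :=
  ((α : ℂ) + φ z) / ((α : ℂ) - φ z)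

theorem circle_sub_ne_zero {α : Circle} {a : ℂ} (ha : ‖a‖ < 1) : (α : ℂ) - a ≠ 0 := by
  intro h
  rw [← sub_eq_zero.1 h, Circle.norm_coe] at ha
  exact lt_irrefl _ ha

theorem differentiableOn_herglotz {n : ℕ} {φ : (Fin n → ℂ) → ℂ} {α : Circle}
    (hφ : DifferentiableOn ℂ φ (polydisc n)) (h1 : ∀ z ∈ polydisc n, ‖φ z‖ < 1) :
    DifferentiableOn ℂ (herglotz φ α) (polydisc n) := by
  have h2 : DifferentiableOn ℂ (fun z => ((α : ℂ) - φ z)⁻¹) (polydisc n) :=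
    (hφ.const_sub _).fun_inv fun z hz => circle_sub_ne_zero (h1 z hz)
  simpa only [herglotz, div_eq_mul_inv] using! (hφ.const_add _).mul h2

/-- As `|α| = 1`, the two factors are `conj α (α - φ(w))` and `α (conj α - conj φ(v))`, exactly the
denominators of the Herglotz transforms up to unimodular constants. This is why `T_α` carries the
factor `1 - α conj I(w)`. -/
theorem herglotz_add_conj {n : ℕ} {φ : (Fin n → ℂ) → ℂ} {α : Circle} {w v : Fin n → ℂ}
    (hw : ‖φ w‖ < 1) (hv : ‖φ v‖ < 1) :
    (herglotz φ α w + conj (herglotz φ α v)) / 2 *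
      ((1 - conj (α : ℂ) * φ w) * (1 - (α : ℂ) * conj (φ v))) = 1 - φ w * conj (φ v) := by
  have hα : (α : ℂ) * conj (α : ℂ) = 1 := by
    simp [Complex.mul_conj, Complex.normSq_eq_norm_sq, Circle.norm_coe]
  have h1 : (α : ℂ) - φ w ≠ 0 := circle_sub_ne_zero hw
  have h2 : conj (α : ℂ) - conj (φ v) ≠ 0 := by
    rw [← map_sub]; exact (map_ne_zero _).2 (circle_sub_ne_zero hv)
  have e1 : 1 - conj (α : ℂ) * φ w = conj (α : ℂ) * (α - φ w) := by linear_combination -hα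
  have e2 : 1 - (α : ℂ) * conj (φ v) = α * (conj (α : ℂ) - conj (φ v)) := by
    linear_combination -hα
  rw [e1, e2]
  simp only [herglotz, map_div₀, map_add, map_sub]
  field_simp
  linear_combination (2 * α * conj (α : ℂ) - 2 * φ w * conj (φ v) + 2) * hα

theorem herglotz_re_pos {n : ℕ} {φ : (Fin n → ℂ) → ℂ} {α : Circle} {z : Fin n → ℂ}
    (hz : ‖φ z‖ < 1) : 0 < (herglotz φ α z).re := by
  have h : (herglotz φ α z).re =
      (1 - ‖φ z‖ ^ 2) / Complex.normSq ((α : ℂ) - φ z) := by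
    have hα : Complex.normSq (α : ℂ) = 1 := by simp [Complex.normSq_eq_norm_sq, Circle.norm_coe]
    rw [herglotz, Complex.div_re, ← add_div, ← Complex.normSq_eq_norm_sq, ← hα]
    simp only [Complex.normSq_apply, Complex.add_re, Complex.sub_re, Complex.add_im,
      Complex.sub_im]
    ring
  rw [h]
  refine div_pos ?_ (Complex.normSq_pos.2 (circle_sub_ne_zero hz))
  nlinarith [norm_nonneg (φ z)]

theorem isClarkMeasure_clarkMeasure {n : ℕ} {φ : (Fin n → ℂ) → ℂ} (α : Circle)
    (hφ : DifferentiableOn ℂ φ (polydisc n)) (h1 : ∀ z ∈ polydisc n, ‖φ z‖ < 1) :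
    IsClarkMeasure φ α (clarkMeasure φ α) := by
  obtain ⟨σ, hσ, hP⟩ := exists_measure_poisson (differentiableOn_herglotz (α := α) hφ h1)
    fun z hz => herglotz_re_pos (h1 z hz)
  have hex : ∃ σ, IsClarkMeasure φ α σ := ⟨σ, hσ, hP⟩
  rw [clarkMeasure, dif_pos hex]
  exact hex.choose_spec

/-! ### Products of Cauchy kernels integrated against a Clark measure -/

/-- The Poisson kernel of the unit disc. -/
noncomputable def discPoisson (z a : ℂ) : ℂ :=
  1 / (1 - z * conj a) * (1 / (1 - a * conj z)) * (1 - z * conj z)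

theorem poissonKernel_eq_prod {n : ℕ} (z : Fin n → ℂ) (ζ : Torus n) :
    poissonKernel z ζ = ∏ j, discPoisson (z j) (ζ j) := by
  simp only [poissonKernel, cauchyKernel, ← Finset.prod_mul_distrib, ← Finset.prod_div_distrib,
    discPoisson, toC, div_div_eq_mul_div, div_one]

theorem continuous_circle_kernel_right {z : ℂ} (hz : ‖z‖ < 1) :
    Continuous fun a : Circle => 1 / (1 - z * conj (a : ℂ)) :=
  Continuous.div (by fun_prop) (by fun_prop) fun a =>
    one_sub_mul_conj_ne_zero' hz (Circle.norm_coe _).le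

theorem continuous_circle_kernel_left {z : ℂ} (hz : ‖z‖ < 1) :
    Continuous fun a : Circle => 1 / (1 - (a : ℂ) * conj z) :=
  Continuous.div (by fun_prop) (by fun_prop) fun a =>
    one_sub_mul_conj_ne_zero (Circle.norm_coe _).le hz

theorem continuous_discPoisson {z : ℂ} (hz : ‖z‖ < 1) :
    Continuous fun a : Circle => discPoisson z a :=
  ((continuous_circle_kernel_right hz).mul (continuous_circle_kernel_left hz)).mul
    continuous_const

theorem conj_discPoisson (z a : ℂ) : conj (discPoisson z a) = discPoisson z a := by
  simp only [discPoisson, map_mul, map_div₀, map_sub, map_one, Complex.conj_conj]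
  ring

/-- The Poisson kernel is the Cauchy kernel times `(1 - z conj z) / (1 - a conj z)`, which is
holomorphic in `a` near the closed disc and equals `1` at `a = z`; the Cauchy formula does the rest.
-/
theorem integral_discPoisson_mul {z v : ℂ} (hz : ‖z‖ < 1) (hv : ‖v‖ < 1) :
    ∫ a : Circle, discPoisson z a * (1 / (1 - (a : ℂ) * conj v)) ∂circleMeasure =
      1 / (1 - z * conj v) := by
  have hzz : 1 - z * conj z ≠ 0 := one_sub_mul_conj_ne_zero hz.le hz
  have hd : ∀ x : ℂ, ‖x‖ ≤ 1 → DifferentiableAt ℂ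
      (fun x => (1 - z * conj z) / (1 - x * conj z) * (1 / (1 - x * conj v))) x := by
    intro x hx
    have hz' := one_sub_mul_conj_ne_zero hx hz
    have hv' := one_sub_mul_conj_ne_zero hx hv
    fun_prop (disch := assumption)
  have h := integral_circle_cauchy hd hz
  simp only [div_self hzz, one_mul] at h
  rw [← h]
  refine integral_congr_ae (ae_of_all _ fun a => ?_)
  simp only [discPoisson]
  ring

theorem integral_discPoisson_mul' {z w : ℂ} (hz : ‖z‖ < 1) (hw : ‖w‖ < 1) :
    ∫ a : Circle, discPoisson z a * (1 / (1 - w * conj (a : ℂ))) ∂circleMeasure =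
      1 / (1 - w * conj z) := by
  have h := congrArg conj (integral_discPoisson_mul hz hw)
  rw [← integral_conj] at h
  simpa only [map_mul, conj_discPoisson, map_div₀, map_one, map_sub, Complex.conj_conj,
    mul_comm _ w] using h

/-- The Poisson extension to the disc of `a ↦ 1 / ((1 - w * conj a) * (1 - a * conj v))`. -/
noncomputable def discKernelExt (w v z : ℂ) : ℂ :=
  1 / (1 - w * conj v) * (1 / (1 - w * conj z) + 1 / (1 - z * conj v) - 1)

/-- With `p = 1 - w conj a` and `q = 1 - a conj v`, the relation `a conj a = 1` gives `1 - w conj v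
= p + q - p q`. Dividing by `p q` splits the product of kernels into an antiholomorphic and a
holomorphic part, each with an obvious harmonic extension. -/
theorem discKernelExt_coe {w v : ℂ} (hw : ‖w‖ < 1) (hv : ‖v‖ < 1) (a : Circle) :
    discKernelExt w v a = 1 / (1 - w * conj (a : ℂ)) * (1 / (1 - (a : ℂ) * conj v)) := by
  have ha : (a : ℂ) * conj (a : ℂ) = 1 := by
    simp [Complex.mul_conj, Complex.normSq_eq_norm_sq, Circle.norm_coe]
  have h1 : 1 - w * conj (a : ℂ) ≠ 0 := one_sub_mul_conj_ne_zero' hw (Circle.norm_coe _).le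
  have h2 : 1 - (a : ℂ) * conj v ≠ 0 := one_sub_mul_conj_ne_zero (Circle.norm_coe _).le hv
  have h3 : 1 - w * conj v ≠ 0 := one_sub_mul_conj_ne_zero hw.le hv
  have h4 : 1 - w * conj v = (1 - w * conj (a : ℂ)) + (1 - (a : ℂ) * conj v) -
      (1 - w * conj (a : ℂ)) * (1 - (a : ℂ) * conj v) := by
    linear_combination (w * conj v) * ha
  rw [h4] at h3
  rw [discKernelExt, h4]
  generalize 1 - w * conj (a : ℂ) = p at *
  generalize 1 - (a : ℂ) * conj v = q at *
  field_simp
  ring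

theorem integral_discPoisson_mul_kernels {z w v : ℂ} (hz : ‖z‖ < 1) (hw : ‖w‖ < 1)
    (hv : ‖v‖ < 1) :
    ∫ a : Circle, discPoisson z a *
      (1 / (1 - w * conj (a : ℂ)) * (1 / (1 - (a : ℂ) * conj v))) ∂circleMeasure =
        discKernelExt w v z := by
  have hint : ∀ F : Circle → ℂ, Continuous F → Integrable F circleMeasure := fun F hF =>
    hF.integrable_of_hasCompactSupport (HasCompactSupport.of_compactSpace _)
  have h0 := integral_discPoisson_mul (v := 0) hz (by simp)
  simp only [map_zero, mul_zero, sub_zero, div_one, mul_one] at h0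
  have h1 := integral_discPoisson_mul hz hv
  have h2 := integral_discPoisson_mul' hz hw
  simp_rw [← discKernelExt_coe hw hv]
  have h3 : ∀ a : Circle, discPoisson z a * discKernelExt w v a = 1 / (1 - w * conj v) *
      (discPoisson z a * (1 / (1 - w * conj (a : ℂ))) +
        discPoisson z a * (1 / (1 - (a : ℂ) * conj v)) - discPoisson z a) := fun a => by
    rw [discKernelExt]; ring
  simp_rw [h3]
  have c0 := continuous_discPoisson hz
  have c1 := hint (fun a => discPoisson z a * (1 / (1 - w * conj (a : ℂ))))
    (c0.mul (continuous_circle_kernel_right hw))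
  have c2 := hint (fun a => discPoisson z a * (1 / (1 - (a : ℂ) * conj v)))
    (c0.mul (continuous_circle_kernel_left hv))
  have e1 := integral_sub (c1.add c2) (hint _ c0)
  have e2 := integral_add c1 c2
  simp only [Pi.add_apply] at e1
  rw [integral_const_mul, e1, e2, h0, h1, h2, discKernelExt]

theorem integral_poissonKernel_mul_kernels {n : ℕ} {z w v : Fin n → ℂ} (hz : z ∈ polydisc n)
    (hw : w ∈ polydisc n) (hv : v ∈ polydisc n) :
    ∫ ζ, poissonKernel z ζ * (cauchyKernel w (toC ζ) * cauchyKernel (toC ζ) v)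
      ∂(torusMeasure n) = ∏ j, discKernelExt (w j) (v j) (z j) := by
  simp_rw [← integral_discPoisson_mul_kernels (hz _) (hw _) (hv _)]
  rw [torusMeasure, ← integral_fintype_prod_eq_prod (fun j (a : Circle) =>
    discPoisson (z j) a * (1 / (1 - w j * conj (a : ℂ)) * (1 / (1 - (a : ℂ) * conj (v j)))))]
  simp only [poissonKernel_eq_prod, cauchyKernel, Finset.prod_mul_distrib, toC]

/-- In each coordinate the kernel is `(1 - r²) / |1 - r ξ conj η|²`, symmetric in `ξ` and `η`. After
Fubini this turns the `σ`-integral into the Poisson integral of `σ` at `r η`. -/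
theorem poissonKernel_dilate_comm {n : ℕ} (r : ℝ) (ξ η : Torus n) :
    poissonKernel ((r : ℂ) • toC ξ) η = poissonKernel ((r : ℂ) • toC η) ξ := by
  rw [poissonKernel_eq_prod, poissonKernel_eq_prod]
  refine Finset.prod_congr rfl fun j _ => ?_
  have h : ∀ a : Circle, conj (a : ℂ) * a = 1 := fun a => by
    simp [Complex.mul_conj, Complex.normSq_eq_norm_sq, Circle.norm_coe, mul_comm]
  have h1 : ∀ a : Circle, (r : ℂ) * a * (r * conj (a : ℂ)) = r * r := fun a => by
    linear_combination (r : ℂ) * r * h a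
  simp only [discPoisson, toC, Pi.smul_apply, smul_eq_mul, map_mul, Complex.conj_ofReal, h1]
  rw [mul_comm (1 / _) (1 / _)]
  congr 4 <;> ring

/-- The bound is uniform in `z`, and so supplies the dominating constant as `r → 1`. -/
theorem norm_discKernelExt_le {w v z : ℂ} (hw : ‖w‖ < 1) (hv : ‖v‖ < 1) (hz : ‖z‖ ≤ 1) :
    ‖discKernelExt w v z‖ ≤
      ‖1 / (1 - w * conj v)‖ * (1 / (1 - ‖w‖) + 1 / (1 - ‖v‖) + 1) := by
  have key : ∀ x y : ℂ, ‖x‖ < 1 → ‖y‖ ≤ 1 → ‖1 / (1 - x * y)‖ ≤ 1 / (1 - ‖x‖) := by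
    intro x y hx hy
    rw [norm_div, norm_one]
    refine one_div_le_one_div_of_le (by linarith) ?_
    have h1 := norm_sub_norm_le 1 (x * y)
    rw [norm_one, norm_mul] at h1
    nlinarith [norm_nonneg x]
  rw [discKernelExt, norm_mul]
  refine mul_le_mul_of_nonneg_left ?_ (norm_nonneg _)
  refine (norm_sub_le _ _).trans (add_le_add ((norm_add_le _ _).trans (add_le_add ?_ ?_)) ?_)
  · exact key _ _ hw (by simpa using hz)
  · rw [mul_comm z, ← RCLike.norm_conj v]
    exact key _ _ (by simpa using hv) hz
  · simp

theorem continuousAt_discKernelExt {w v z : ℂ} (hw : ‖w‖ < 1) (hv : ‖v‖ < 1) (hz : ‖z‖ ≤ 1) :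
    ContinuousAt (discKernelExt w v) z := by
  have h1 : ContinuousAt (fun z => 1 / (1 - w * conj z)) z :=
    ContinuousAt.div (by fun_prop) (by fun_prop) (one_sub_mul_conj_ne_zero' hw hz)
  have h2 : ContinuousAt (fun z => 1 / (1 - z * conj v)) z :=
    ContinuousAt.div (by fun_prop) (by fun_prop) (one_sub_mul_conj_ne_zero hz hv)
  exact ((h1.add h2).sub continuousAt_const).const_mul _

theorem continuous_smul_toC_apply {n : ℕ} (c : ℂ) (j : Fin n) :
    Continuous fun ξ : Torus n => (c • toC ξ) j :=
  continuous_const.mul ((continuous_apply j).comp continuous_toC)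

/-- A measure whose Poisson integral is the real part of a holomorphic function `F` integrates
products of two Cauchy kernels as the polarization of that real part does. -/
theorem integral_cauchyKernel_mul_of_poisson {n : ℕ} {F : (Fin n → ℂ) → ℂ}
    (hF : DifferentiableOn ℂ F (polydisc n)) {σ : Measure (Torus n)} [IsFiniteMeasure σ]
    (hσ : ∀ z ∈ polydisc n, ∫ ζ, poissonKernel z ζ ∂σ = ((F z).re : ℂ)) {w v : Fin n → ℂ}
    (hw : w ∈ polydisc n) (hv : v ∈ polydisc n) :
    ∫ ξ, cauchyKernel w (toC ξ) * cauchyKernel (toC ξ) v ∂σ =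
      cauchyKernel w v * ((F w + conj (F v)) / 2) := by
  have hmem : ∀ r ∈ Ioo (0 : ℝ) 1, ∀ ξ : Torus n, (r : ℂ) • toC ξ ∈ polydisc n :=
    fun r hr ξ => smul_mem_polydisc (fun j => (norm_toC ξ j).le) hr
  -- The integrand is the Poisson extension of `C(w,·) C(·,v)` at `r ξ`. Moving the Poisson kernel
  -- onto `σ` leaves the kernels integrated against `Re F(r η) dm`.
  have hswap : ∀ r ∈ Ioo (0 : ℝ) 1,
      ∫ ξ, ∏ j, discKernelExt (w j) (v j) (((r : ℂ) • toC ξ) j) ∂σ =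
        cauchyKernel w v * ((F ((r : ℂ) • w) + conj (F ((r : ℂ) • v))) / 2) := by
    intro r hr
    have hcont : Continuous (Function.uncurry fun ξ η : Torus n =>
        poissonKernel ((r : ℂ) • toC ξ) η *
          (cauchyKernel w (toC η) * cauchyKernel (toC η) v)) := by
      refine Continuous.mul ?_ ((continuous_cauchyKernel_mul hw hv).comp continuous_snd)
      simp only [poissonKernel_eq_prod, discPoisson]
      refine continuous_finsetProd _ fun j _ => ?_
      have h1 : Continuous fun p : Torus n × Torus n => ((r : ℂ) • toC p.1) j :=
        (continuous_smul_toC_apply r j).comp continuous_fst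
      have h2 : Continuous fun p : Torus n × Torus n => (p.2 j : ℂ) :=
        (continuous_apply j).comp (continuous_toC.comp continuous_snd)
      have h3 := h1.star
      have h4 := h2.star
      refine ((continuous_const.div (continuous_const.sub (h1.mul h4)) fun p => ?_).mul
        (continuous_const.div (continuous_const.sub (h2.mul h3)) fun p => ?_)).mul
          (continuous_const.sub (h1.mul h3))
      · exact one_sub_mul_conj_ne_zero' (hmem r hr p.1 j) (Circle.norm_coe _).le
      · exact one_sub_mul_conj_ne_zero (Circle.norm_coe _).le (hmem r hr p.1 j)
    calc ∫ ξ, ∏ j, discKernelExt (w j) (v j) (((r : ℂ) • toC ξ) j) ∂σ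
        = ∫ ξ, ∫ η, poissonKernel ((r : ℂ) • toC ξ) η *
            (cauchyKernel w (toC η) * cauchyKernel (toC η) v) ∂(torusMeasure n) ∂σ := by
          simp_rw [integral_poissonKernel_mul_kernels (hmem r hr _) hw hv]
      _ = ∫ η, ∫ ξ, poissonKernel ((r : ℂ) • toC ξ) η *
            (cauchyKernel w (toC η) * cauchyKernel (toC η) v) ∂σ ∂(torusMeasure n) :=
          integral_integral_swap
            (hcont.integrable_of_hasCompactSupport (HasCompactSupport.of_compactSpace _))
      _ = ∫ η, cauchyKernel w (toC η) * cauchyKernel (toC η) v *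
            ((F ((r : ℂ) • toC η)).re : ℂ) ∂(torusMeasure n) := by
          refine integral_congr_ae (ae_of_all _ fun η => ?_)
          simp only
          rw [integral_mul_const]
          simp_rw [poissonKernel_dilate_comm r _ η]
          rw [hσ _ (hmem r hr η), mul_comm]
      _ = _ := integral_cauchyKernel_mul_cauchyKernel_mul_re (differentiableAt_dilate hF hr) hw hv
  have hlim1 : Tendsto (fun r : ℝ => cauchyKernel w v *
      ((F ((r : ℂ) • w) + conj (F ((r : ℂ) • v))) / 2)) (𝓝[<] 1)
        (𝓝 (cauchyKernel w v * ((F w + conj (F v)) / 2))) :=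
    (((tendsto_dilate hF hw).add ((Complex.continuous_conj.tendsto _).comp
      (tendsto_dilate hF hv))).div_const _).const_mul _
  have hlim2 : Tendsto (fun r : ℝ => ∫ ξ, ∏ j, discKernelExt (w j) (v j) (((r : ℂ) • toC ξ) j) ∂σ)
      (𝓝[<] 1) (𝓝 (∫ ξ, cauchyKernel w (toC ξ) * cauchyKernel (toC ξ) v ∂σ)) := by
    refine tendsto_integral_filter_of_dominated_convergence (fun _ => ∏ j,
      ‖1 / (1 - w j * conj (v j))‖ * (1 / (1 - ‖w j‖) + 1 / (1 - ‖v j‖) + 1)) ?_ ?_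
      (integrable_const _) ?_
    · filter_upwards [Ioo_mem_nhdsLT_one] with r hr
      refine Continuous.aestronglyMeasurable (continuous_finsetProd _ fun j _ => ?_)
      refine continuous_iff_continuousAt.2 fun ξ => ?_
      refine ContinuousAt.comp (f := fun ξ : Torus n => ((r : ℂ) • toC ξ) j)
        (continuousAt_discKernelExt (hw j) (hv j) (hmem r hr ξ j).le) ?_
      exact (continuous_smul_toC_apply r j).continuousAt
    · filter_upwards [Ioo_mem_nhdsLT_one] with r hr
      refine ae_of_all _ fun ξ => ?_
      rw [norm_prod]
      exact Finset.prod_le_prod (fun j _ => norm_nonneg _) fun j _ =>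
        norm_discKernelExt_le (hw j) (hv j) (hmem r hr ξ j).le
    · refine ae_of_all _ fun ξ => ?_
      simp only [cauchyKernel, ← Finset.prod_mul_distrib, toC]
      refine tendsto_finsetProd _ fun j _ => ?_
      rw [← discKernelExt_coe (hw j) (hv j)]
      have h1 : ContinuousAt (fun r : ℝ => discKernelExt (w j) (v j) ((r : ℂ) * ξ j)) 1 := by
        refine ContinuousAt.comp (f := fun r : ℝ => (r : ℂ) * ξ j)
          (continuousAt_discKernelExt (hw j) (hv j) ?_) (by fun_prop)
        simp [Circle.norm_coe]
      have h2 := h1.tendsto.mono_left (nhdsWithin_le_nhds (s := Iio 1))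
      simpa [toC] using h2
  refine tendsto_nhds_unique hlim2 (hlim1.congr' ?_)
  filter_upwards [Ioo_mem_nhdsLT_one] with r hr
  exact (hswap r hr).symm

/-! ### Boundary values of functions in the Hardy space -/

/-- A sequence bounded in `L²` and tending to zero almost everywhere tends to zero weakly. -/
theorem tendsto_integral_mul_zero_of_bounded {X ι : Type*} [MeasurableSpace X] {μ : Measure X}
    {l : Filter ι} [l.IsCountablyGenerated] {h : ι → X → ℂ} {p : X → ℂ} (hp : MemLp p 2 μ)
    (hh : ∀ᶠ i in l, MemLp (h i) 2 μ) {C : ℝ} (hC : ∀ᶠ i in l, ∫ x, ‖h i x‖ ^ 2 ∂μ ≤ C)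
    (h0 : ∀ᵐ x ∂μ, Tendsto (fun i => h i x) l (𝓝 0)) :
    Tendsto (fun i => ∫ x, p x * h i x ∂μ) l (𝓝 0) := by
  have hp2 : Integrable (fun x => ‖p x‖ ^ 2) μ := (memLp_two_iff_integrable_sq_norm hp.1).1 hp
  rw [Metric.tendsto_nhds]
  intro ε hε
  -- Chosen so that `M⁻¹ |C| < ε / 2`. Where `‖h‖ ≤ M ‖p‖` the product is dominated by the
  -- integrable `M ‖p‖²`, so its contribution tends to zero; elsewhere `‖p‖ ‖h‖ ≤ M⁻¹ ‖h‖²`, which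
  -- the `L²` bound controls.
  set M : ℝ := 2 * (|C| + 1) / ε with hM
  have hM0 : 0 < M := by positivity
  have hlim : Tendsto (fun i => ∫ x, min (‖p x‖ * ‖h i x‖) (M * ‖p x‖ ^ 2) ∂μ) l (𝓝 0) := by
    have := tendsto_integral_filter_of_dominated_convergence (μ := μ) (l := l)
      (F := fun i x => min (‖p x‖ * ‖h i x‖) (M * ‖p x‖ ^ 2)) (f := fun _ => (0 : ℝ))
      (fun x => M * ‖p x‖ ^ 2) ?_ ?_ (hp2.const_mul M) ?_
    · simpa using this
    · filter_upwards [hh] with i hi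
      exact (hp.1.norm.mul hi.1.norm).inf ((hp.1.norm.pow 2).const_mul M)
    · refine Eventually.of_forall fun i => ae_of_all _ fun x => ?_
      rw [Real.norm_of_nonneg (by positivity)]
      exact min_le_right _ _
    · filter_upwards [h0] with x hx
      have h1 := (hx.norm.const_mul ‖p x‖).min (tendsto_const_nhds (x := M * ‖p x‖ ^ 2))
      have h2 : min (‖p x‖ * ‖(0 : ℂ)‖) (M * ‖p x‖ ^ 2) = 0 := by
        rw [norm_zero, mul_zero]; exact min_eq_left (by positivity)
      rwa [h2] at h1
  filter_upwards [hh, hC, hlim.eventually_lt_const (half_pos hε)] with i hi hCi hlt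
  have hi2 : Integrable (fun x => ‖h i x‖ ^ 2) μ := (memLp_two_iff_integrable_sq_norm hi.1).1 hi
  have hmin : Integrable (fun x => min (‖p x‖ * ‖h i x‖) (M * ‖p x‖ ^ 2)) μ := by
    refine (hp2.const_mul M).mono' ((hp.1.norm.mul hi.1.norm).inf
      ((hp.1.norm.pow 2).const_mul M)) (ae_of_all _ fun x => ?_)
    rw [Real.norm_of_nonneg (by positivity)]
    exact min_le_right _ _
  have hle : ‖∫ x, p x * h i x ∂μ‖ ≤
      ∫ x, (min (‖p x‖ * ‖h i x‖) (M * ‖p x‖ ^ 2) + M⁻¹ * ‖h i x‖ ^ 2) ∂μ := by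
    refine norm_integral_le_of_norm_le (hmin.add (hi2.const_mul _)) (ae_of_all _ fun x => ?_)
    rw [norm_mul]
    rcases le_total (‖p x‖ * ‖h i x‖) (M * ‖p x‖ ^ 2) with hc | hc
    · rw [min_eq_left hc]
      have : 0 ≤ M⁻¹ * ‖h i x‖ ^ 2 := by positivity
      linarith
    · rw [min_eq_right hc]
      have h1 : ‖p x‖ * ‖h i x‖ ≤ M⁻¹ * ‖h i x‖ ^ 2 := by
        rcases (norm_nonneg (p x)).eq_or_lt with h0 | h0
        · rw [← h0, zero_mul]; positivity
        · have h2 : M * ‖p x‖ ≤ ‖h i x‖ := by nlinarith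
          rw [inv_mul_eq_div, le_div_iff₀ hM0]
          nlinarith [norm_nonneg (h i x)]
      have : 0 ≤ M * ‖p x‖ ^ 2 := by positivity
      linarith
  rw [integral_add hmin (hi2.const_mul _), integral_const_mul] at hle
  rw [dist_zero_right]
  have h3 : M⁻¹ * ∫ x, ‖h i x‖ ^ 2 ∂μ ≤ M⁻¹ * |C| :=
    mul_le_mul_of_nonneg_left (hCi.trans (le_abs_self C)) (by positivity)
  have h4 : M⁻¹ * |C| < ε / 2 := by
    rw [hM, inv_div, div_mul_eq_mul_div, div_lt_div_iff₀ (by positivity) two_pos]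
    nlinarith [abs_nonneg C]
  linarith

theorem memLp_dilate {n : ℕ} {f : (Fin n → ℂ) → ℂ} (hf : DifferentiableOn ℂ f (polydisc n))
    {r : ℝ} (hr : r ∈ Ioo (0 : ℝ) 1) :
    MemLp (fun ζ : Torus n => f ((r : ℂ) • toC ζ)) 2 (torusMeasure n) :=
  (continuous_dilate hf hr).memLp_of_hasCompactSupport (HasCompactSupport.of_compactSpace _)

theorem MemHardy.integral_norm_sq_le {n : ℕ} {f : (Fin n → ℂ) → ℂ} (hf : MemHardy f) :
    ∃ C : ℝ, ∀ r ∈ Ioo (0 : ℝ) 1, ∫ ζ, ‖f ((r : ℂ) • toC ζ)‖ ^ 2 ∂(torusMeasure n) ≤ C := by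
  refine ⟨(⨆ r ∈ Ioo (0 : ℝ) 1,
    ∫⁻ ζ, ‖f ((r : ℂ) • toC ζ)‖ₑ ^ 2 ∂(torusMeasure n)).toReal, fun r hr => ?_⟩
  rw [integral_eq_lintegral_of_nonneg_ae (f := fun ζ => ‖f ((r : ℂ) • toC ζ)‖ ^ 2) (ae_of_all _ fun ζ => by positivity)
    ((continuous_dilate hf.holo hr).norm.pow 2).aestronglyMeasurable]
  refine ENNReal.toReal_mono hf.bdd.ne ?_
  refine le_trans (le_of_eq ?_) (le_iSup₂_of_le r hr le_rfl)
  refine lintegral_congr fun ζ => ?_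
  rw [ENNReal.ofReal_pow (norm_nonneg _), ofReal_norm]

/-- The dilates of a function in the Hardy space converge weakly to its boundary values. -/
theorem MemHardy.tendsto_integral_mul {n : ℕ} {f : (Fin n → ℂ) → ℂ} (hf : MemHardy f)
    {g p : Torus n → ℂ} (hg : MemLp g 2 (torusMeasure n)) (hp : MemLp p 2 (torusMeasure n))
    (hfg : HasBoundaryValues f g) :
    Tendsto (fun r : ℝ => ∫ ζ, p ζ * f ((r : ℂ) • toC ζ) ∂(torusMeasure n)) (𝓝[<] 1)
      (𝓝 (∫ ζ, p ζ * g ζ ∂(torusMeasure n))) := by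
  obtain ⟨C, hC⟩ := hf.integral_norm_sq_le
  have h := tendsto_integral_mul_zero_of_bounded (μ := torusMeasure n) (l := 𝓝[<] (1 : ℝ))
    (h := fun r ζ => f ((r : ℂ) • toC ζ) - g ζ) hp
    (C := 2 * C + 2 * ∫ ζ, ‖g ζ‖ ^ 2 ∂(torusMeasure n)) ?_ ?_ ?_
  · have h2 := h.add_const (∫ ζ, p ζ * g ζ ∂(torusMeasure n))
    rw [zero_add] at h2
    refine h2.congr' ?_
    filter_upwards [Ioo_mem_nhdsLT_one] with r hr
    have i1 : Integrable (fun ζ => p ζ * f ((r : ℂ) • toC ζ)) (torusMeasure n) :=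
      hp.integrable_mul (memLp_dilate hf.holo hr)
    have i2 : Integrable (fun ζ => p ζ * g ζ) (torusMeasure n) := hp.integrable_mul hg
    simp_rw [mul_sub]
    rw [integral_sub i1 i2, sub_add_cancel]
  · filter_upwards [Ioo_mem_nhdsLT_one] with r hr
    exact (memLp_dilate hf.holo hr).sub hg
  · filter_upwards [Ioo_mem_nhdsLT_one] with r hr
    have hfr := memLp_dilate hf.holo hr
    have i1 := (memLp_two_iff_integrable_sq_norm hfr.1).1 hfr
    have i2 := (memLp_two_iff_integrable_sq_norm hg.1).1 hg
    have i3 := (memLp_two_iff_integrable_sq_norm (hfr.sub hg).1).1 (hfr.sub hg)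
    calc ∫ ζ, ‖f ((r : ℂ) • toC ζ) - g ζ‖ ^ 2 ∂(torusMeasure n)
        ≤ ∫ ζ, (2 * ‖f ((r : ℂ) • toC ζ)‖ ^ 2 + 2 * ‖g ζ‖ ^ 2) ∂(torusMeasure n) := by
          refine integral_mono i3 ((i1.const_mul 2).add (i2.const_mul 2)) fun ζ => ?_
          have h1 := norm_sub_le (f ((r : ℂ) • toC ζ)) (g ζ)
          change ‖f ((r : ℂ) • toC ζ) - g ζ‖ ^ 2 ≤ _
          nlinarith [norm_nonneg (f ((r : ℂ) • toC ζ) - g ζ),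
            sq_nonneg (‖f ((r : ℂ) • toC ζ)‖ - ‖g ζ‖)]
      _ ≤ _ := by
          rw [integral_add (i1.const_mul 2) (i2.const_mul 2), integral_const_mul,
            integral_const_mul]
          linarith [hC r hr]
  · filter_upwards [hfg] with ζ hζ
    simpa using hζ.sub_const (g ζ)

theorem memLp_cauchyKernel_right {n : ℕ} {w : Fin n → ℂ} (hw : w ∈ polydisc n) :
    MemLp (fun ζ => cauchyKernel w (toC ζ)) 2 (torusMeasure n) :=
  (continuous_cauchyKernel_right hw).memLp_of_hasCompactSupport
    (HasCompactSupport.of_compactSpace _)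

theorem memLp_cauchyKernel_left {n : ℕ} {w : Fin n → ℂ} (hw : w ∈ polydisc n)
    (μ : Measure (Torus n)) [IsFiniteMeasure μ] :
    MemLp (fun ζ => cauchyKernel (toC ζ) w) 2 μ :=
  (continuous_cauchyKernel_left hw).memLp_of_hasCompactSupport
    (HasCompactSupport.of_compactSpace _)

/-- The Cauchy formula for the boundary values of a function in the Hardy space. -/
theorem MemHardy.cauchy_formula {n : ℕ} {f : (Fin n → ℂ) → ℂ} (hf : MemHardy f)
    {g : Torus n → ℂ} (hg : MemLp g 2 (torusMeasure n)) (hfg : HasBoundaryValues f g)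
    {w : Fin n → ℂ} (hw : w ∈ polydisc n) :
    ∫ ζ, cauchyKernel w (toC ζ) * g ζ ∂(torusMeasure n) = f w := by
  refine tendsto_nhds_unique (hf.tendsto_integral_mul hg (memLp_cauchyKernel_right hw) hfg)
    ((tendsto_dilate hf.holo hw).congr' ?_)
  filter_upwards [Ioo_mem_nhdsLT_one] with r hr
  exact (integral_cauchyKernel_mul (differentiableAt_dilate hf.holo hr) hw).symm

theorem MemHardy.bounded_mul {n : ℕ} {u f : (Fin n → ℂ) → ℂ} (hf : MemHardy f)
    (hu : DifferentiableOn ℂ u (polydisc n)) {B : ℝ} (hB : ∀ z ∈ polydisc n, ‖u z‖ ≤ B) :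
    MemHardy fun z => u z * f z := by
  refine ⟨hu.mul hf.holo, ?_⟩
  have hfin := ENNReal.mul_lt_top (a := ENNReal.ofReal B ^ 2)
    (ENNReal.pow_lt_top ENNReal.ofReal_lt_top) hf.bdd
  refine lt_of_le_of_lt (iSup₂_le fun r hr => ?_) hfin
  calc ∫⁻ ζ, ‖u ((r : ℂ) • toC ζ) * f ((r : ℂ) • toC ζ)‖ₑ ^ 2 ∂(torusMeasure n)
      ≤ ∫⁻ ζ, ENNReal.ofReal B ^ 2 * ‖f ((r : ℂ) • toC ζ)‖ₑ ^ 2 ∂(torusMeasure n) := by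
        refine lintegral_mono fun ζ => ?_
        rw [enorm_mul, mul_pow]
        gcongr
        rw [← ofReal_norm]
        exact ENNReal.ofReal_le_ofReal (hB _ (smul_mem_polydisc (fun j => (norm_toC ζ j).le) hr))
    _ = ENNReal.ofReal B ^ 2 * ∫⁻ ζ, ‖f ((r : ℂ) • toC ζ)‖ₑ ^ 2 ∂(torusMeasure n) :=
        lintegral_const_mul' _ _ (ENNReal.pow_lt_top ENNReal.ofReal_lt_top).ne
    _ ≤ _ := by
        gcongr
        exact le_iSup₂_of_le r hr le_rfl

theorem MemHardy.one {n : ℕ} : MemHardy (fun _ : Fin n → ℂ => (1 : ℂ)) :=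
  ⟨differentiableOn_const _, by
    refine lt_of_le_of_lt (iSup₂_le fun r hr => ?_) ENNReal.one_lt_top
    simp⟩

theorem norm_cauchyKernel_le {n : ℕ} {w z : Fin n → ℂ} (hw : w ∈ polydisc n)
    (hz : z ∈ polydisc n) : ‖cauchyKernel z w‖ ≤ ∏ j, (1 / (1 - ‖w j‖)) := by
  rw [cauchyKernel, norm_prod]
  refine Finset.prod_le_prod (fun j _ => norm_nonneg _) fun j _ => ?_
  have h1 := norm_sub_norm_le 1 (z j * conj (w j))
  rw [norm_one, norm_mul, RCLike.norm_conj] at h1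
  have := hw j
  have := hz j
  rw [norm_div, norm_one]
  exact one_div_le_one_div_of_le (by linarith) (by nlinarith [norm_nonneg (w j)])

theorem differentiableOn_cauchyKernel {n : ℕ} {w : Fin n → ℂ} (hw : w ∈ polydisc n) :
    DifferentiableOn ℂ (fun z => cauchyKernel z w) (polydisc n) := fun _ hz =>
  (differentiableAt_cauchyKernel fun j =>
    one_sub_mul_conj_ne_zero (hz j).le (hw j)).differentiableWithinAt

theorem memHardy_cauchyKernel {n : ℕ} {w : Fin n → ℂ} (hw : w ∈ polydisc n) :
    MemHardy fun z => cauchyKernel z w := by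
  simpa using MemHardy.one.bounded_mul (differentiableOn_cauchyKernel hw)
    fun _ hz => norm_cauchyKernel_le hw hz

theorem tendsto_cauchyKernel_dilate {n : ℕ} {w : Fin n → ℂ} (hw : w ∈ polydisc n)
    (ζ : Torus n) : Tendsto (fun r : ℝ => cauchyKernel ((r : ℂ) • toC ζ) w) (𝓝[<] 1)
      (𝓝 (cauchyKernel (toC ζ) w)) := by
  have h : ContinuousAt (fun z => cauchyKernel z w) (((1 : ℝ) : ℂ) • toC ζ) := by
    refine (differentiableAt_cauchyKernel fun j => ?_).continuousAt
    exact one_sub_mul_conj_ne_zero (by simp [norm_toC]) (hw j)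
  have h2 : ContinuousAt (fun r : ℝ => cauchyKernel ((r : ℂ) • toC ζ) w) 1 :=
    ContinuousAt.comp (f := fun r : ℝ => (r : ℂ) • toC ζ) h (by fun_prop)
  simpa using h2.tendsto.mono_left nhdsWithin_le_nhds

/-- The Cauchy kernel `C(·, w)` as an element of `L²(𝕋ⁿ)`. -/
noncomputable def cauchyLp {n : ℕ} (w : polydisc n) : Lp ℂ 2 (torusMeasure n) :=
  (memLp_cauchyKernel_left w.2 (torusMeasure n)).toLp _

theorem inner_cauchyLp {n : ℕ} (w : polydisc n) (g : Lp ℂ 2 (torusMeasure n)) :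
    inner ℂ (cauchyLp w) g = ∫ ζ, cauchyKernel (w : Fin n → ℂ) (toC ζ) * g ζ ∂(torusMeasure n) := by
  rw [L2.inner_def]
  refine integral_congr_ae ?_
  filter_upwards [(memLp_cauchyKernel_left w.2 (torusMeasure n)).coeFn_toLp] with ζ h
  rw [cauchyLp, h, RCLike.inner_apply, conj_cauchyKernel, mul_comm]

theorem cauchyKernel_dilate_comm {n : ℕ} (r : ℝ) (z w : Fin n → ℂ) :
    cauchyKernel ((r : ℂ) • z) w = cauchyKernel z ((r : ℂ) • w) := by
  simp only [cauchyKernel, Pi.smul_apply, smul_eq_mul, map_mul, Complex.conj_ofReal]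
  refine Finset.prod_congr rfl fun j _ => ?_
  ring

/-- The Cauchy formula for the dilate of `f`, at the point `r ζ`, writes `f(r² ζ)` as an average
over `η` of `C(r ζ, η) = C(ζ, r η)`. So a function orthogonal to every Cauchy kernel is orthogonal
to this dilate, by Fubini. -/
theorem integral_conj_mul_dilate_eq_zero {n : ℕ} {f : (Fin n → ℂ) → ℂ}
    (hf : DifferentiableOn ℂ f (polydisc n)) {p : Torus n → ℂ}
    (hp : MemLp p 2 (torusMeasure n))
    (h0 : ∀ w ∈ polydisc n, ∫ ζ, cauchyKernel w (toC ζ) * p ζ ∂(torusMeasure n) = 0)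
    {r : ℝ} (hr : r ∈ Ioo (0 : ℝ) 1) :
    ∫ ζ, conj (p ζ) * f (((r * r : ℝ) : ℂ) • toC ζ) ∂(torusMeasure n) = 0 := by
  have hmem : ∀ ξ : Torus n, (r : ℂ) • toC ξ ∈ polydisc n :=
    fun ξ => smul_mem_polydisc (fun j => (norm_toC ξ j).le) hr
  have hrep : ∀ ζ : Torus n, f (((r * r : ℝ) : ℂ) • toC ζ) =
      ∫ η, cauchyKernel ((r : ℂ) • toC ζ) (toC η) * f ((r : ℂ) • toC η) ∂(torusMeasure n) := by
    intro ζ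
    rw [integral_cauchyKernel_mul (differentiableAt_dilate hf hr) (hmem ζ), smul_smul,
      Complex.ofReal_mul]
  have hcont : Continuous fun q : Torus n × Torus n =>
      cauchyKernel ((r : ℂ) • toC q.1) (toC q.2) * f ((r : ℂ) • toC q.2) := by
    refine Continuous.mul ?_ ((continuous_dilate hf hr).comp continuous_snd)
    refine continuous_finsetProd _ fun j _ => continuous_const.div (continuous_const.sub
      (((continuous_smul_toC_apply r j).comp continuous_fst).mul
        ((continuous_apply j).comp (continuous_toC.comp continuous_snd)).star)) fun q => ?_
    exact one_sub_mul_conj_ne_zero' (hmem q.1 j) (norm_toC q.2 j).le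
  obtain ⟨B, hB⟩ := isCompact_univ.exists_bound_of_continuousOn hcont.continuousOn
  have hpi : Integrable (fun ζ => conj (p ζ)) (torusMeasure n) :=
    hp.star.integrable (by norm_num)
  have hint : Integrable (Function.uncurry fun ζ η : Torus n => conj (p ζ) *
      (cauchyKernel ((r : ℂ) • toC ζ) (toC η) * f ((r : ℂ) • toC η)))
      ((torusMeasure n).prod (torusMeasure n)) :=
    (hpi.comp_fst (torusMeasure n)).mul_bdd (c := B) hcont.aestronglyMeasurable
      (ae_of_all _ fun q => hB q (mem_univ _))
  simp_rw [hrep, ← integral_const_mul]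
  rw [integral_integral_swap hint]
  refine integral_eq_zero_of_ae (ae_of_all _ fun η => ?_)
  have h1 := congrArg conj (h0 _ (hmem η))
  rw [← integral_conj] at h1
  simp only [map_mul, conj_cauchyKernel, map_zero] at h1
  simp only [Pi.zero_apply]
  calc ∫ ζ, conj (p ζ) * (cauchyKernel ((r : ℂ) • toC ζ) (toC η) * f ((r : ℂ) • toC η))
        ∂(torusMeasure n)
      = ∫ ζ, cauchyKernel (toC ζ) ((r : ℂ) • toC η) * conj (p ζ) * f ((r : ℂ) • toC η)
        ∂(torusMeasure n) := by
        refine integral_congr_ae (ae_of_all _ fun ζ => ?_)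
        simp only [cauchyKernel_dilate_comm]
        ring
    _ = 0 := by rw [integral_mul_const, h1, zero_mul]

theorem hardySpace_le_closure_span (n : ℕ) :
    hardySpace n ≤ (Submodule.span ℂ (range (cauchyLp (n := n)))).topologicalClosure := by
  rintro g ⟨f, hf, hfg⟩
  simp only [one_mul] at hfg
  rw [← Submodule.orthogonal_orthogonal_eq_closure, Submodule.mem_orthogonal]
  intro p hp
  have h0 : ∀ w ∈ polydisc n, ∫ ζ, cauchyKernel w (toC ζ) * p ζ ∂(torusMeasure n) = 0 := by
    intro w hw
    rw [← inner_cauchyLp ⟨w, hw⟩]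
    exact (Submodule.mem_orthogonal _ _).1 hp _ (Submodule.subset_span ⟨_, rfl⟩)
  have hps : MemLp (fun ζ => conj (p ζ)) 2 (torusMeasure n) := (Lp.memLp p).star
  have hlim := hf.tendsto_integral_mul (Lp.memLp g) hps hfg
  -- Orthogonality is known for dilates written with radius `r * r`, so the weak limit is
  -- reparametrized accordingly.
  have hsq : Tendsto (fun r : ℝ => r * r) (𝓝[<] 1) (𝓝[<] 1) := by
    refine tendsto_nhdsWithin_iff.2 ⟨?_, ?_⟩
    · have : ContinuousAt (fun r : ℝ => r * r) 1 := by fun_prop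
      simpa using this.tendsto.mono_left (nhdsWithin_le_nhds (s := Iio 1))
    · filter_upwards [Ioo_mem_nhdsLT_one] with r hr
      exact mul_lt_one_of_nonneg_of_lt_one_left hr.1.le hr.2 hr.2.le
  have hz : Tendsto (fun _ : ℝ => (0 : ℂ)) (𝓝[<] (1 : ℝ))
      (𝓝 (∫ ζ, conj (p ζ) * g ζ ∂(torusMeasure n))) := by
    refine (hlim.comp hsq).congr' ?_
    filter_upwards [Ioo_mem_nhdsLT_one] with r hr
    exact integral_conj_mul_dilate_eq_zero hf.holo (Lp.memLp p) h0 hr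
  rw [L2.inner_def, tendsto_nhds_unique tendsto_const_nhds hz]
  refine integral_congr_ae (ae_of_all _ fun ζ => ?_)
  simp only [RCLike.inner_apply, mul_comm]

end ClarkTorus

/-! ### Isometries determined by a dense family -/

/-- A family with dense span and a family with the same Gram matrix in a complete space are
related by exactly one linear isometry. -/
theorem existsUnique_linearIsometry_of_inner_eq {ι E F : Type*}
    [NormedAddCommGroup E] [InnerProductSpace ℂ E] [NormedAddCommGroup F] [InnerProductSpace ℂ F]
    [CompleteSpace F] (u : ι → E) (v : ι → F)
    (hu : DenseRange (Finsupp.linearCombination ℂ u))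
    (h : ∀ i j, inner ℂ (v i) (v j) = inner ℂ (u i) (u j)) :
    ∃! T : E →ₗᵢ[ℂ] F, ∀ i, T (u i) = v i := by
  have hnorm : ∀ x, ‖Finsupp.linearCombination ℂ v x‖ = ‖Finsupp.linearCombination ℂ u x‖ := by
    intro x
    -- Equal Gram matrices give equal norms of corresponding linear combinations, so the map on the
    -- span is well defined, isometric, and extends by continuity.
    have : inner ℂ (Finsupp.linearCombination ℂ v x) (Finsupp.linearCombination ℂ v x) =
        inner ℂ (Finsupp.linearCombination ℂ u x) (Finsupp.linearCombination ℂ u x) := by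
      simp only [Finsupp.linearCombination_apply, Finsupp.sum, sum_inner, inner_sum,
        inner_smul_left, inner_smul_right, h]
    rw [inner_self_eq_norm_sq_to_K, inner_self_eq_norm_sq_to_K] at this
    norm_cast at this
    exact (sq_eq_sq₀ (norm_nonneg _) (norm_nonneg _)).1 (by exact_mod_cast this)
  have hb : ∀ x, ‖Finsupp.linearCombination ℂ v x‖ ≤ 1 * ‖Finsupp.linearCombination ℂ u x‖ :=
    fun x => by rw [one_mul, hnorm]
  set T₀ := (Finsupp.linearCombination ℂ v).extendOfNorm (Finsupp.linearCombination ℂ u) with hT₀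
  have hext : ∀ x, T₀ (Finsupp.linearCombination ℂ u x) = Finsupp.linearCombination ℂ v x :=
    LinearMap.extendOfNorm_eq hu ⟨1, hb⟩
  have hiso : ∀ x, ‖T₀ x‖ = ‖x‖ := fun x => by
    refine hu.induction_on x (isClosed_eq (by fun_prop) (by fun_prop)) fun a => ?_
    rw [hext, hnorm]
  refine ⟨⟨T₀.toLinearMap, hiso⟩, fun i => ?_, fun S hS => ?_⟩
  · simpa using hext (Finsupp.single i 1)
  · refine LinearIsometry.ext fun x => ?_
    change S x = T₀ x
    refine hu.induction_on x (isClosed_eq S.continuous T₀.continuous) fun a => ?_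
    rw [hext]
    simp [Finsupp.linearCombination_apply, Finsupp.sum, hS]

namespace ClarkTorus

/-! ### The model space -/

theorem HasBoundaryValues.congr_ae {n : ℕ} {f : (Fin n → ℂ) → ℂ} {g g' : Torus n → ℂ}
    (h : HasBoundaryValues f g) (hg : g' =ᵐ[torusMeasure n] g) : HasBoundaryValues f g' := by
  filter_upwards [h, hg] with ζ h1 h2
  rwa [h2]

theorem HasBoundaryValues.aestronglyMeasurable {n : ℕ} {f : (Fin n → ℂ) → ℂ} {g : Torus n → ℂ}
    (h : HasBoundaryValues f g) (hf : DifferentiableOn ℂ f (polydisc n)) :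
    AEStronglyMeasurable g (torusMeasure n) := by
  obtain ⟨r, -, hr, hr1⟩ := exists_seq_strictMono_tendsto' (zero_lt_one' ℝ)
  have hr2 : Tendsto r atTop (𝓝[<] 1) :=
    tendsto_nhdsWithin_iff.2 ⟨hr1, Eventually.of_forall fun k => (hr k).2⟩
  refine aestronglyMeasurable_of_tendsto_ae atTop
    (f := fun k ζ => f ((r k : ℂ) • toC ζ))
    (fun k => (continuous_dilate hf (hr k)).aestronglyMeasurable) ?_
  filter_upwards [h] with ζ hζ
  exact hζ.comp hr2

theorem IsInner.exists_boundaryValues {n : ℕ} {I : (Fin n → ℂ) → ℂ} (hI : IsInner I) :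
    ∃ J : Torus n → ℂ, AEStronglyMeasurable J (torusMeasure n) ∧
      (∀ᵐ ζ ∂(torusMeasure n), ‖J ζ‖ = 1) ∧ HasBoundaryValues I J := by
  classical
  -- The limit is chosen pointwise, with the value `0` on the null set where no unimodular limit
  -- exists; measurability follows afterwards, as an a.e. limit of continuous dilates.
  let J : Torus n → ℂ := fun ζ =>
    if h : ∃ c : ℂ, ‖c‖ = 1 ∧ Tendsto (fun r : ℝ => I ((r : ℂ) • toC ζ)) (𝓝[<] 1) (𝓝 c)
    then h.choose else 0
  have hJ : ∀ᵐ ζ ∂(torusMeasure n), ‖J ζ‖ = 1 ∧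
      Tendsto (fun r : ℝ => I ((r : ℂ) • toC ζ)) (𝓝[<] 1) (𝓝 (J ζ)) := by
    filter_upwards [hI.boundary] with ζ hζ
    simp only [J, dif_pos hζ]
    exact hζ.choose_spec
  have hb : HasBoundaryValues I J := hJ.mono fun _ h => h.2
  exact ⟨J, hb.aestronglyMeasurable hI.holo, hJ.mono fun _ h => h.1, hb⟩

theorem memLp_boundary_mul {n : ℕ} {J g : Torus n → ℂ}
    (hJ : AEStronglyMeasurable J (torusMeasure n)) (hJ1 : ∀ᵐ ζ ∂(torusMeasure n), ‖J ζ‖ = 1)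
    (hg : MemLp g 2 (torusMeasure n)) : MemLp (fun ζ => J ζ * g ζ) 2 (torusMeasure n) := by
  refine hg.of_le (hJ.mul hg.1) ?_
  filter_upwards [hJ1] with ζ h
  rw [norm_mul, h, one_mul]

theorem memHardy_modelKernel {n : ℕ} {I : (Fin n → ℂ) → ℂ} (hI : IsInner I) {w : Fin n → ℂ}
    (hw : w ∈ polydisc n) : MemHardy (modelKernel I w) := by
  refine (memHardy_cauchyKernel hw).bounded_mul (u := fun z => 1 - I z * conj (I w))
    ((hI.holo.mul_const _).const_sub _) (B := 2) fun z hz => ?_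
  refine (norm_sub_le _ _).trans ?_
  rw [norm_one, norm_mul, RCLike.norm_conj]
  nlinarith [hI.norm_lt_one z hz, hI.norm_lt_one w hw, norm_nonneg (I z), norm_nonneg (I w)]

/-- The boundary function of `I C(·, w)`, where `J` is the boundary function of `I`. -/
theorem hasBoundaryValues_mul_cauchyKernel {n : ℕ} {I : (Fin n → ℂ) → ℂ} {J : Torus n → ℂ}
    (hIJ : HasBoundaryValues I J) {w : Fin n → ℂ} (hw : w ∈ polydisc n) :
    HasBoundaryValues (fun z => I z * cauchyKernel z w) fun ζ => J ζ * cauchyKernel (toC ζ) w := by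
  filter_upwards [hIJ] with ζ h
  exact h.mul (tendsto_cauchyKernel_dilate hw ζ)

theorem hasBoundaryValues_modelKernel {n : ℕ} {I : (Fin n → ℂ) → ℂ} {J : Torus n → ℂ}
    (hIJ : HasBoundaryValues I J) {w : Fin n → ℂ} (hw : w ∈ polydisc n) :
    HasBoundaryValues (modelKernel I w) fun ζ =>
      cauchyKernel (toC ζ) w - conj (I w) * (J ζ * cauchyKernel (toC ζ) w) := by
  filter_upwards [hasBoundaryValues_mul_cauchyKernel hIJ hw] with ζ h
  have h1 := (tendsto_cauchyKernel_dilate hw ζ).sub (h.const_mul (conj (I w)))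
  refine h1.congr fun r => ?_
  rw [modelKernel]
  ring

/-- Dividing the boundary function of `I h` by that of the inner function `I`. -/
theorem hasBoundaryValues_conj_mul {n : ℕ} {I h : (Fin n → ℂ) → ℂ} {J g : Torus n → ℂ}
    (hIJ : HasBoundaryValues I J) (hJ1 : ∀ᵐ ζ ∂(torusMeasure n), ‖J ζ‖ = 1)
    (hg : HasBoundaryValues (fun z => I z * h z) g) :
    HasBoundaryValues h fun ζ => conj (J ζ) * g ζ := by
  filter_upwards [hIJ, hJ1, hg] with ζ h1 h2 h3
  have hJ0 : J ζ ≠ 0 := by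
    rw [← norm_ne_zero_iff, h2]
    exact one_ne_zero
  have hinv : conj (J ζ) = (J ζ)⁻¹ := by
    rw [Complex.inv_def, Complex.normSq_eq_norm_sq, h2]
    simp
  rw [hinv]
  refine ((h1.inv₀ hJ0).mul h3).congr' ?_
  -- `I` may vanish in the polydisc, but not at `r ζ` for `r` close to `1`, since the limit is
  -- unimodular.
  filter_upwards [h1.eventually_ne hJ0] with r hr
  rw [inv_mul_cancel_left₀ hr]

/-! ### Kernel functions in the model space and their images in `L²(σ)` -/

section ModelKernels

variable {n : ℕ} {I : (Fin n → ℂ) → ℂ} {J : Torus n → ℂ}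

/-- The boundary function of `I C(·, w)` in `L²(𝕋ⁿ)`. -/
noncomputable def innerMulCauchyLp (hJ : AEStronglyMeasurable J (torusMeasure n))
    (hJ1 : ∀ᵐ ζ ∂(torusMeasure n), ‖J ζ‖ = 1) (w : polydisc n) : Lp ℂ 2 (torusMeasure n) :=
  (memLp_boundary_mul hJ hJ1 (memLp_cauchyKernel_left w.2 (torusMeasure n))).toLp _

/-- The boundary function of the kernel function `K_w` in `L²(𝕋ⁿ)`. -/
noncomputable def modelKernelLp (I : (Fin n → ℂ) → ℂ)
    (hJ : AEStronglyMeasurable J (torusMeasure n)) (hJ1 : ∀ᵐ ζ ∂(torusMeasure n), ‖J ζ‖ = 1)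
    (w : polydisc n) : Lp ℂ 2 (torusMeasure n) :=
  cauchyLp w - conj (I w) • innerMulCauchyLp hJ hJ1 w

theorem coeFn_innerMulCauchyLp (hJ : AEStronglyMeasurable J (torusMeasure n))
    (hJ1 : ∀ᵐ ζ ∂(torusMeasure n), ‖J ζ‖ = 1) (w : polydisc n) :
    innerMulCauchyLp hJ hJ1 w =ᵐ[torusMeasure n]
      fun ζ => J ζ * cauchyKernel (toC ζ) (w : Fin n → ℂ) :=
  MemLp.coeFn_toLp _

theorem innerMulCauchyLp_mem (hIJ : HasBoundaryValues I J)
    (hJ : AEStronglyMeasurable J (torusMeasure n)) (hJ1 : ∀ᵐ ζ ∂(torusMeasure n), ‖J ζ‖ = 1)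
    (w : polydisc n) : innerMulCauchyLp hJ hJ1 w ∈ mulHardy I :=
  ⟨_, memHardy_cauchyKernel w.2,
    (hasBoundaryValues_mul_cauchyKernel hIJ w.2).congr_ae (coeFn_innerMulCauchyLp hJ hJ1 w)⟩

theorem hasBoundaryValues_modelKernelLp (hIJ : HasBoundaryValues I J)
    (hJ : AEStronglyMeasurable J (torusMeasure n)) (hJ1 : ∀ᵐ ζ ∂(torusMeasure n), ‖J ζ‖ = 1)
    (w : polydisc n) : HasBoundaryValues (modelKernel I w) (modelKernelLp I hJ hJ1 w) := by
  refine (hasBoundaryValues_modelKernel hIJ w.2).congr_ae ?_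
  filter_upwards [Lp.coeFn_sub (cauchyLp w) (conj (I w) • innerMulCauchyLp hJ hJ1 w),
    Lp.coeFn_smul (conj (I w)) (innerMulCauchyLp hJ hJ1 w), coeFn_innerMulCauchyLp hJ hJ1 w,
    (memLp_cauchyKernel_left w.2 (torusMeasure n)).coeFn_toLp] with ζ h1 h2 h3 h4
  rw [modelKernelLp, h1, Pi.sub_apply, h2, Pi.smul_apply, h3, cauchyLp, h4, smul_eq_mul]

theorem inner_innerMulCauchyLp (hJ : AEStronglyMeasurable J (torusMeasure n))
    (hJ1 : ∀ᵐ ζ ∂(torusMeasure n), ‖J ζ‖ = 1) (w : polydisc n) (g : Lp ℂ 2 (torusMeasure n)) :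
    inner ℂ (innerMulCauchyLp hJ hJ1 w) g =
      ∫ ζ, cauchyKernel (w : Fin n → ℂ) (toC ζ) * (conj (J ζ) * g ζ) ∂(torusMeasure n) := by
  rw [L2.inner_def]
  refine integral_congr_ae ?_
  filter_upwards [coeFn_innerMulCauchyLp hJ hJ1 w] with ζ h
  rw [h, RCLike.inner_apply, map_mul, conj_cauchyKernel]
  ring

theorem inner_modelKernelLp (hJ : AEStronglyMeasurable J (torusMeasure n))
    (hJ1 : ∀ᵐ ζ ∂(torusMeasure n), ‖J ζ‖ = 1) (w : polydisc n) (g : Lp ℂ 2 (torusMeasure n)) :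
    inner ℂ (modelKernelLp I hJ hJ1 w) g =
      inner ℂ (cauchyLp w) g - I w * inner ℂ (innerMulCauchyLp hJ hJ1 w) g := by
  rw [modelKernelLp, inner_sub_left, inner_smul_left, Complex.conj_conj]

/-- Against the boundary function `g` of `I h`, the term `C(·, w)` yields `I(w) h(w)`. The term `I
C(·, w)` yields `h(w)`, because `conj J * g` is the boundary function of `h`; with its coefficient
`I(w)` the two cancel. -/
theorem modelKernelLp_mem (hI : IsInner I) (hIJ : HasBoundaryValues I J)
    (hJ : AEStronglyMeasurable J (torusMeasure n)) (hJ1 : ∀ᵐ ζ ∂(torusMeasure n), ‖J ζ‖ = 1)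
    (w : polydisc n) : modelKernelLp I hJ hJ1 w ∈ modelSpace I := by
  refine ⟨⟨modelKernel I w, memHardy_modelKernel hI w.2, ?_⟩, ?_⟩
  · simpa only [one_mul] using hasBoundaryValues_modelKernelLp hIJ hJ hJ1 w
  · refine (Submodule.mem_orthogonal' _ _).2 ?_
    rintro g ⟨h, hh, hg⟩
    have hJ1' : ∀ᵐ ζ ∂(torusMeasure n), ‖conj (J ζ)‖ = 1 :=
      hJ1.mono fun ζ h => by rw [RCLike.norm_conj, h]
    rw [inner_modelKernelLp, inner_cauchyLp, inner_innerMulCauchyLp,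
      (hh.bounded_mul hI.holo fun z hz => (hI.norm_lt_one z hz).le).cauchy_formula
        (Lp.memLp g) hg w.2,
      hh.cauchy_formula (g := fun ζ => conj (J ζ) * g ζ)
        (memLp_boundary_mul hJ.star hJ1' (Lp.memLp g)) (hasBoundaryValues_conj_mul hIJ hJ1 hg) w.2, sub_self]

theorem inner_modelKernelLp_eq (hIJ : HasBoundaryValues I J)
    (hJ : AEStronglyMeasurable J (torusMeasure n)) (hJ1 : ∀ᵐ ζ ∂(torusMeasure n), ‖J ζ‖ = 1)
    (w : polydisc n) {f : (Fin n → ℂ) → ℂ} (hf : MemHardy f) {g : Lp ℂ 2 (torusMeasure n)}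
    (hg : g ∈ modelSpace I) (hfg : HasBoundaryValues f g) :
    inner ℂ (modelKernelLp I hJ hJ1 w) g = f w := by
  rw [inner_modelKernelLp, inner_cauchyLp, hf.cauchy_formula (Lp.memLp g) hfg w.2,
    (Submodule.mem_orthogonal _ _).1 hg.2 _ (innerMulCauchyLp_mem hIJ hJ hJ1 w), mul_zero, sub_zero]

theorem modelSpace_le_closure_span (hI : IsInner I) (hIJ : HasBoundaryValues I J)
    (hJ : AEStronglyMeasurable J (torusMeasure n)) (hJ1 : ∀ᵐ ζ ∂(torusMeasure n), ‖J ζ‖ = 1) :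
    modelSpace I ≤
      (Submodule.span ℂ (range (modelKernelLp I hJ hJ1))).topologicalClosure := by
  intro g hg
  -- Projecting onto the orthogonal complement, which is always closed, makes it unnecessary to know
  -- that `mulHardy I` is closed.
  let Q := ((mulHardy I)ᗮ).starProjection
  have hQg : Q g = g := Submodule.starProjection_eq_self_iff.2 hg.2
  have hQ : ∀ w, Q (cauchyLp w) = modelKernelLp I hJ hJ1 w := by
    intro w
    have h1 : Q (modelKernelLp I hJ hJ1 w) = modelKernelLp I hJ hJ1 w :=
      Submodule.starProjection_eq_self_iff.2 (modelKernelLp_mem hI hIJ hJ hJ1 w).2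
    have h2 : Q (innerMulCauchyLp hJ hJ1 w) = 0 :=
      (Submodule.starProjection_apply_eq_zero_iff _).2
        (Submodule.le_orthogonal_orthogonal _ (innerMulCauchyLp_mem hIJ hJ hJ1 w))
    have h3 : cauchyLp w = modelKernelLp I hJ hJ1 w + conj (I w) • innerMulCauchyLp hJ hJ1 w := by
      rw [modelKernelLp, sub_add_cancel]
    rw [h3, map_add, h1, map_smul, h2, smul_zero, add_zero]
  rw [← hQg]
  refine map_mem_closure Q.continuous (hardySpace_le_closure_span n hg.1) fun x hx => ?_
  refine Submodule.span_induction (p := fun x _ =>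
    Q x ∈ Submodule.span ℂ (range (modelKernelLp I hJ hJ1))) ?_ ?_ ?_ ?_ hx
  · rintro _ ⟨w, rfl⟩
    rw [hQ]
    exact Submodule.subset_span ⟨w, rfl⟩
  · rw [map_zero]
    exact Submodule.zero_mem _
  · intro x y _ _ hx hy
    rw [map_add]
    exact Submodule.add_mem _ hx hy
  · intro c x _ hx
    rw [map_smul]
    exact Submodule.smul_mem _ c hx

/-- The kernel function `K_w` as an element of the model space. -/
noncomputable def modelKernelVec (hI : IsInner I) (hIJ : HasBoundaryValues I J)
    (hJ : AEStronglyMeasurable J (torusMeasure n)) (hJ1 : ∀ᵐ ζ ∂(torusMeasure n), ‖J ζ‖ = 1)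
    (w : polydisc n) : modelSpace I :=
  ⟨modelKernelLp I hJ hJ1 w, modelKernelLp_mem hI hIJ hJ hJ1 w⟩

theorem denseRange_linearCombination_modelKernelVec (hI : IsInner I) (hIJ : HasBoundaryValues I J)
    (hJ : AEStronglyMeasurable J (torusMeasure n)) (hJ1 : ∀ᵐ ζ ∂(torusMeasure n), ‖J ζ‖ = 1) :
    DenseRange (Finsupp.linearCombination ℂ (modelKernelVec hI hIJ hJ hJ1)) := by
  intro x
  rw [closure_subtype]
  refine closure_mono ?_ (modelSpace_le_closure_span hI hIJ hJ hJ1 x.2)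
  intro y hy
  obtain ⟨a, rfl⟩ := (Finsupp.mem_span_range_iff_exists_finsupp).1 hy
  refine ⟨_, ⟨a, rfl⟩, ?_⟩
  simp [Finsupp.linearCombination_apply, Finsupp.sum, modelKernelVec]

/-- The function `(1 - α conj (I w)) C(·, w)` in `L²(σ)`. -/
noncomputable def clarkKernelLp (I : (Fin n → ℂ) → ℂ) (α : Circle) (σ : Measure (Torus n))
    [IsFiniteMeasure σ] (w : polydisc n) : Lp ℂ 2 σ :=
  ((memLp_cauchyKernel_left w.2 σ).const_mul (1 - (α : ℂ) * conj (I w))).toLp _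

theorem coeFn_clarkKernelLp (α : Circle) (σ : Measure (Torus n)) [IsFiniteMeasure σ]
    (w : polydisc n) : clarkKernelLp I α σ w =ᵐ[σ]
      fun ξ => (1 - (α : ℂ) * conj (I w)) * cauchyKernel (toC ξ) (w : Fin n → ℂ) :=
  MemLp.coeFn_toLp _

/-- The inner product is conjugate-linear in its first argument, so the value is `K_v(w)`, in the
same order as the reproducing property gives for `⟨K_w, K_v⟩` in the model space. -/
theorem inner_clarkKernelLp (hI : IsInner I) {α : Circle} {σ : Measure (Torus n)}
    [IsFiniteMeasure σ] (hσ : IsClarkMeasure I α σ) (w v : polydisc n) :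
    inner ℂ (clarkKernelLp I α σ w) (clarkKernelLp I α σ v) = modelKernel I v w := by
  have h1 : inner ℂ (clarkKernelLp I α σ w) (clarkKernelLp I α σ v) =
      ∫ ξ, (1 - conj (α : ℂ) * I w) * (1 - (α : ℂ) * conj (I v)) *
        (cauchyKernel (w : Fin n → ℂ) (toC ξ) * cauchyKernel (toC ξ) (v : Fin n → ℂ)) ∂σ := by
    rw [L2.inner_def]
    refine integral_congr_ae ?_
    filter_upwards [coeFn_clarkKernelLp (I := I) α σ w, coeFn_clarkKernelLp (I := I) α σ v]
      with ξ h h'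
    rw [h, h', RCLike.inner_apply, map_mul, conj_cauchyKernel]
    simp only [map_sub, map_one, map_mul, Complex.conj_conj]
    ring
  rw [h1, integral_const_mul, integral_cauchyKernel_mul_of_poisson
    (differentiableOn_herglotz (α := α) hI.holo hI.norm_lt_one) hσ.poisson w.2 v.2, modelKernel,
    ← herglotz_add_conj (α := α) (hI.norm_lt_one _ w.2) (hI.norm_lt_one _ v.2)]
  ring

end ModelKernels

end ClarkTorus

open ClarkTorus in
theorem theorem3p1 {n : ℕ} (hn : 1 ≤ n) (I : (Fin n → ℂ) → ℂ) (hI : IsInner I) (α : Circle) :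
    -- `σ_α[I]` is the finite positive measure with the prescribed Poisson integral
    IsClarkMeasure I α (clarkMeasure I α) ∧
    -- `K w` is the kernel function `K_w`, as an element of the model space
    ∃ K : polydisc n → modelSpace I,
      (∀ w : polydisc n, HasBoundaryValues (modelKernel I w) (K w : Lp ℂ 2 (torusMeasure n))) ∧
      -- it reproduces the functions in the model space
      (∀ f : (Fin n → ℂ) → ℂ, MemHardy f → ∀ g : modelSpace I,
        HasBoundaryValues f (g : Lp ℂ 2 (torusMeasure n)) →
        ∀ w : polydisc n, inner ℂ (K w) g = f w) ∧
      -- the map `T_α` extends uniquely from the kernel functions to an isometry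
      ∃! T : modelSpace I →ₗᵢ[ℂ] Lp ℂ 2 (clarkMeasure I α),
        ∀ w : polydisc n, (T (K w) : Torus n → ℂ) =ᵐ[clarkMeasure I α]
          fun ξ => (1 - (α : ℂ) * (starRingEnd ℂ) (I w)) * cauchyKernel (toC ξ) w := by
  have hσ := isClarkMeasure_clarkMeasure α hI.holo hI.norm_lt_one
  have := hσ.isFiniteMeasure
  obtain ⟨J, hJ, hJ1, hIJ⟩ := hI.exists_boundaryValues
  have hrep : ∀ f : (Fin n → ℂ) → ℂ, MemHardy f → ∀ g : modelSpace I,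
      HasBoundaryValues f (g : Lp ℂ 2 (torusMeasure n)) →
      ∀ w : polydisc n, inner ℂ (modelKernelVec hI hIJ hJ hJ1 w) g = f w :=
    fun f hf g hfg w => inner_modelKernelLp_eq hIJ hJ hJ1 w hf g.2 hfg
  have hbv := hasBoundaryValues_modelKernelLp hIJ hJ hJ1
  refine ⟨hσ, modelKernelVec hI hIJ hJ hJ1, hbv, hrep, ?_⟩
  have hT := existsUnique_linearIsometry_of_inner_eq (modelKernelVec hI hIJ hJ hJ1)
    (clarkKernelLp I α (clarkMeasure I α))
    (denseRange_linearCombination_modelKernelVec hI hIJ hJ hJ1) fun w v => by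
      rw [inner_clarkKernelLp hI hσ, hrep _ (memHardy_modelKernel hI v.2) _ (hbv v)]
  -- The a.e. formula for `T (K w)` is the same as its equality with `clarkKernelLp` in `L²(σ)`, so
  -- unique existence carries over.
  refine (existsUnique_congr fun T => forall_congr' fun w => ?_).1 hT
  have hB := coeFn_clarkKernelLp (I := I) α (clarkMeasure I α) w
  exact ⟨fun h => by rw [h]; exact hB, fun h => Lp.ext (h.trans hB.symm)⟩
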